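/- **Lemma 3.3.** Let $\gamma>0$ and $l,\chi\ge 0$. There is a constant $C$, depending only on $\gamma,l,\chi$, such that the following holds for all $p,r$. Let $\mathbb{R}^{p\times r}$ carry the trace inner product and the Frobenius norm $\|\cdot\|$, and let $\mathcal M\subset\mathbb{R}^{p\times r}$ be a compact smooth embedded submanifold with the induced metric which is $2\gamma$-proximally smooth, i.e. every $s$ with $\mathrm{dist}(s,\mathcal M)<2\gamma$ has a unique nearest point in $\mathcal M$. Let $\mathcal P_{\mathcal M}(s)\in\operatorname{argmin}_{y\in\mathcal M}\|s-y\|$ for every $s\in\mathbb{R}^{p\times r}$ (any choice of minimizers). Let $\xi\sim\mathcal D$, let $F(\cdot,\xi)$ be a random real function on $\mathbb{R}^{p\times r}$, and let $f$ be a real function on $\mathbb{R}^{p\times r}$, differentiable along $\mathcal M$. Write $\mathtt{grad}$ for the Riemannian gradient on $\mathcal M$ and $\nabla$ for the Euclidean gradient. Suppose that * $F(x,\xi)$ is integrable with $\mathbb E_\xi[F(x,\xi)]=f(x)$ for every $x\in\mathbb{R}^{p\times r}$, and, for every $x\in\mathcal M$, $\mathtt{grad}F(x,\xi)$ is integrable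 with $\mathbb E_\xi[\mathtt{grad}F(x,\xi)]=\mathtt{grad}f(x)$ and $\mathbb E_\xi\|\mathtt{grad}F(x,\xi)-\mathtt{grad}f(x)\|^2\le\sigma^2$ (for some real $\sigma$); * almost surely, $F(\cdot,\xi)$ is differentiable at every point of $\mathrm{conv}(\mathcal M)$, $\|\nabla F(x,\xi)\|\le\chi$ for all $x\in\mathcal M$, and $\|\nabla F(x,\xi)-\nabla F(y,\xi)\|\le l\|x-y\|$ for all $x,y\in\mathrm{conv}(\mathcal M)$. Let $m\ge1$, let $u_1,\dots,u_m$ be independent and uniformly distributed on the unit sphere of $\mathbb{R}^{p\times r}$, let $\xi_1,\dots,\xi_m$ be independent with law $\mathcal D$, and let $(u_j)_j$ and $(\xi_j)_j$ be independent of each other. For $x\in\mathcal M$ and $0<\mu\le\gamma$ put $$G^{\mathtt P}_\mu(x)=\frac{pr}{m}\sum_{j=1}^m\frac{F(\mathcal P_{\mathcal M}(x+\mu u_j),\xi_j)-F(x,\xi_j)}{\mu}\,u_j .$$ Then $G^{\mathtt P}_\mu(x)$ is integrable and $$\big\|\mathbb E[G^{\mathtt P}_\mu(x)]-\mathtt{grad}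 f(x)\big\|\le\chi_f\,\mu\qquad\text{with }\chi_f=C\,pr .$$ -/

import Mathlib

open MeasureTheory ProbabilityTheory Set Filter Topology
open scoped Gradient InnerProductSpace

/-- The space of real `p × r` matrices with the trace inner product `⟨x, y⟩ = Tr (xᵀ y)` and hence
the Frobenius norm: the Euclidean space whose coordinates are the matrix entries. -/
abbrev MatSpace (p r : ℕ) : Type := EuclideanSpace ℝ (Fin p × Fin r)

section Geometry

variable {E : Type*} [NormedAddCommGroup E] [InnerProductSpace ℝ E]

/-- `M` is a smooth embedded submanifold of codimension `k`: around each of its points it is the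
zero set of a smooth map to `ℝ^k` (a local defining function) whose differential at the point is
onto. -/
def IsSmoothSubmanifold (k : ℕ) (M : Set E) : Prop :=
  ∀ x ∈ M, ∃ (U : Set E) (φ : E → EuclideanSpace ℝ (Fin k)),
    IsOpen U ∧ x ∈ U ∧ ContDiffOn ℝ (⊤ : ℕ∞) φ U ∧ M ∩ U = {y ∈ U | φ y = 0} ∧
      Function.Surjective (fderiv ℝ φ x)

/-- `c` is a smooth curve in `M`, defined near time `0`, that passes through `x` at time `0` with
velocity `v`. -/
def IsCurveAt (M : Set E) (x : E) (c : ℝ → E) (v : E) : Prop :=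
  c 0 = x ∧ HasDerivAt c v 0 ∧
    ∃ ε > 0, ContDiffOn ℝ (⊤ : ℕ∞) c (Ioo (-ε) ε) ∧ ∀ t ∈ Ioo (-ε) ε, c t ∈ M

/-- The tangent space of `M` at `x`: the velocities at `x` of the smooth curves in `M` through `x`.
(For a smooth submanifold these velocities already form a linear subspace, so that taking the span
adds nothing.) -/
def tangentSpaceAt (M : Set E) (x : E) : Submodule ℝ E :=
  Submodule.span ℝ {v | ∃ c, IsCurveAt M x c v}

/-- `g` is the Riemannian gradient at `x` of the function `f` on `M`, for the metric induced from
the ambient space: `g` is tangent at `x`, and the derivative `D f(x)[v]` of `f` along each tangent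
vector `v`, computed along any smooth curve in `M` with velocity `v`, exists and is `⟨g, v⟩`. -/
def IsRiemGrad (M : Set E) (f : E → ℝ) (x g : E) : Prop :=
  g ∈ tangentSpaceAt M x ∧
    ∀ c v, IsCurveAt M x c v → HasDerivAt (fun t => f (c t)) ⟪g, v⟫_ℝ 0

theorem IsRiemGrad.unique {M : Set E} {f : E → ℝ} {x g g' : E}
    (h : IsRiemGrad M f x g) (h' : IsRiemGrad M f x g') : g = g' := by
  have key : ∀ w ∈ tangentSpaceAt M x, ⟪g - g', w⟫_ℝ = 0 := by
    intro w hw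
    induction hw using Submodule.span_induction with
    | mem v hv =>
      obtain ⟨c, hc⟩ := hv
      rw [inner_sub_left, (h.2 c v hc).unique (h'.2 c v hc), sub_self]
    | zero => simp
    | add a b _ _ ha hb => rw [inner_add_right, ha, hb, add_zero]
    | smul a b _ hb => rw [inner_smul_right, hb, mul_zero]
  have h0 := key (g - g') (Submodule.sub_mem _ h.1 h'.1)
  exact sub_eq_zero.mp (inner_self_eq_zero.mp h0)

open Classical in
/-- The Riemannian gradient `grad f(x)`: the unique vector as in `IsRiemGrad` (and `0` when `f` is
not differentiable along `M` at `x`). -/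
noncomputable def riemGrad (M : Set E) (f : E → ℝ) (x : E) : E :=
  if h : ∃ g, IsRiemGrad M f x g then h.choose else 0

theorem IsRiemGrad.riemGrad_eq {M : Set E} {f : E → ℝ} {x g : E}
    (h : IsRiemGrad M f x g) : riemGrad M f x = g := by
  have hex : ∃ g, IsRiemGrad M f x g := ⟨g, h⟩
  rw [riemGrad, dif_pos hex]
  exact hex.choose_spec.unique h

/-- `y` is a point of `M` nearest to `s`, that is, `y` minimizes `‖s - z‖` over `z ∈ M`. -/
def IsNearestPt (M : Set E) (s y : E) : Prop :=
  y ∈ M ∧ ∀ z ∈ M, ‖s - y‖ ≤ ‖s - z‖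

/-- `M` is `ρ`-proximally smooth: every point at distance less than `ρ` from `M` has a unique
nearest point in `M`. -/
def ProximallySmooth (ρ : ℝ) (M : Set E) : Prop :=
  ∀ s, Metric.infDist s M < ρ → ∃! y, IsNearestPt M s y

end Geometry

section Oracle

variable {E : Type*} [NormedAddCommGroup E] [InnerProductSpace ℝ E]
  {S : Type*} [MeasurableSpace S]

/-- `F(x, ξ)`, with `ξ` of law `D`, is an unbiased oracle for the values of `f`, with
an unbiased Riemannian gradient of variance at most `σ²` on `M`. -/
structure UnbiasedOracle (M : Set E) (D : Measure S) (F : E → S → ℝ) (f : E → ℝ) (σ : ℝ) :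
    Prop where
  integrable : ∀ x, Integrable (F x) D
  mean_eq : ∀ x, ∫ ξ, F x ξ ∂D = f x
  /-- `f` is differentiable along `M`. -/
  exists_grad : ∀ x ∈ M, ∃ g, IsRiemGrad M f x g
  grad_integrable : ∀ x ∈ M, Integrable (fun ξ => riemGrad M (fun y => F y ξ) x) D
  grad_mean_eq : ∀ x ∈ M, ∫ ξ, riemGrad M (fun y => F y ξ) x ∂D = riemGrad M f x
  grad_variance_le : ∀ x ∈ M,
    ∫ ξ, ‖riemGrad M (fun y => F y ξ) x - riemGrad M f x‖ ^ 2 ∂D ≤ σ ^ 2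

/-- Almost surely, the Euclidean gradient `∇F(·, ξ)` is bounded by `χ` on `M`, and `F(·, ξ)` is
`l`-smooth (differentiable, with `l`-Lipschitz Euclidean gradient) on the convex hull of `M`. -/
structure SmoothOracle [CompleteSpace E] (M : Set E) (D : Measure S) (F : E → S → ℝ) (l χ : ℝ) :
    Prop where
  grad_bound : ∀ᵐ ξ ∂D, ∀ x ∈ M, ‖∇ (fun y => F y ξ) x‖ ≤ χ
  differentiable : ∀ᵐ ξ ∂D, ∀ x ∈ convexHull ℝ M, DifferentiableAt ℝ (fun y => F y ξ) x
  grad_lipschitz : ∀ᵐ ξ ∂D, ∀ x ∈ convexHull ℝ M, ∀ y ∈ convexHull ℝ M,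
    ‖∇ (fun z => F z ξ) x - ∇ (fun z => F z ξ) y‖ ≤ l * ‖x - y‖

end Oracle

/-- The uniform distribution on the unit sphere of `ℝ^{p × r}`, as a measure on `ℝ^{p × r}`: the
surface measure of the sphere, normalized to total mass one. -/
noncomputable def sphereUniform (p r : ℕ) : Measure (MatSpace p r) :=
  (((volume : Measure (MatSpace p r)).toSphere univ)⁻¹ •
    (volume : Measure (MatSpace p r)).toSphere).map Subtype.val

/-- The projection-based zeroth-order estimator
`(pr / m) ∑_j (F(P(x + μ u_j), ξ_j) - F(x, ξ_j)) / μ • u_j`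
for given directions `u_j` and samples `ξ_j`, where `P` is the projection. -/
noncomputable def projEstimator {p r m : ℕ} {S : Type*} (P : MatSpace p r → MatSpace p r)
    (F : MatSpace p r → S → ℝ) (μ : ℝ) (x : MatSpace p r)
    (u : Fin m → MatSpace p r) (ξ : Fin m → S) : MatSpace p r :=
  ((p * r : ℝ) / m) • ∑ j, ((F (P (x + μ • u j)) (ξ j) - F x (ξ j)) / μ) • u j

/-! Write `R = 2γ`, `y = P (x + v)` with `v = μ u`, and let `g` be the Riemannian gradient at `x` of
one sample `h = F(·, ξ)`. The heart is the expansion `h y - h x = ⟪g, v⟫ + O(‖v‖²)`, with a constant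
depending only on `l`, `χ` and `R` (`ProximallySmooth.abs_comp_proj_sub_le`). Since `⟪g, u⟫ u` has
mean `g / (pr)` for uniform `u`, averaging over `u` and `ξ` and multiplying by `pr` leaves `grad
f(x)` plus an error of order `pr μ`.

The expansion has three errors. The Taylor remainder is controlled by the Lipschitz gradient on the
convex hull. The normal part of the gradient meets the chord `y - x`, and Federer's inequality
(`ProximallySmooth.inner_le`) makes this quadratic. Finally, `x + v - y` is normal at `y`, so
pairing it with the tangent vector `g` sees only the normal part of `g` at `y`; this is small
because tangent spaces vary in a Lipschitz way (`ProximallySmooth.norm_sub_starProjection_le`).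

Both geometric facts must have constants governed by `R` alone. Smoothness gives qualitative local
statements on scales that depend on `M`. For Federer's inequality, a small exterior tangent ball is
enlarged to radius `R`; for tangent spaces, a local bound is chained along a projected segment. In
both cases the scale drops out. -/

theorem exists_norm_sub_sub_le_sq {E F : Type*} [NormedAddCommGroup E]
    [NormedSpace ℝ E] [NormedAddCommGroup F] [NormedSpace ℝ F]
    {ψ : E → F} {x : E} (hψ : ContDiffAt ℝ 2 ψ x) :
    ∃ K ≥ (0 : ℝ), ∃ ρ > 0, ∀ z, ‖z - x‖ < ρ →
      ‖ψ z - ψ x - fderiv ℝ ψ x (z - x)‖ ≤ K * ‖z - x‖ ^ 2 := by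
  have h1 : ContDiffAt ℝ 1 (fderiv ℝ ψ) x := hψ.fderiv_right (by norm_num)
  obtain ⟨K, t, ht, hK⟩ := h1.exists_lipschitzOnWith
  have hd : ∀ᶠ y in 𝓝 x, DifferentiableAt ℝ ψ y := by
    filter_upwards [hψ.eventually (by simp)] with y hy
    exact hy.differentiableAt (by norm_num)
  obtain ⟨ρ, hρ, hball⟩ := Metric.mem_nhds_iff.1 (inter_mem ht hd)
  refine ⟨K, K.2, ρ, hρ, fun z hz => ?_⟩
  have hxs : x ∈ segment ℝ x z := left_mem_segment _ _ _
  have hdist : ∀ y ∈ segment ℝ x z, ‖y - x‖ ≤ ‖z - x‖ := by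
    rintro y hy
    rw [segment_eq_image'] at hy
    obtain ⟨θ, hθ, rfl⟩ := hy
    simp only [add_sub_cancel_left, norm_smul, Real.norm_eq_abs, abs_of_nonneg hθ.1]
    exact mul_le_of_le_one_left (norm_nonneg _) hθ.2
  have hsub : ∀ y ∈ segment ℝ x z, y ∈ t ∩ {y | DifferentiableAt ℝ ψ y} := fun y hy =>
    hball (by rw [Metric.mem_ball, dist_eq_norm]; exact (hdist y hy).trans_lt hz)
  have := (convex_segment x z).norm_image_sub_le_of_norm_hasFDerivWithin_le' (f := ψ)
    (f' := fderiv ℝ ψ) (φ := fderiv ℝ ψ x) (C := K * ‖z - x‖)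
    (fun y hy => (hsub y hy).2.hasFDerivAt.hasFDerivWithinAt)
    (fun y hy => by
      refine (hK.norm_sub_le (hsub y hy).1 (hsub x hxs).1).trans ?_
      gcongr
      exact hdist y hy) hxs (right_mem_segment _ _ _)
  calc _ ≤ _ := this
    _ = _ := by ring

/-! ### Tangent and normal spaces through local defining functions -/

section LocalDefiningFunction

variable {E : Type*} [NormedAddCommGroup E] [InnerProductSpace ℝ E]
  {k : ℕ} {M U : Set E} {φ : E → EuclideanSpace ℝ (Fin k)}

theorem tangentSpaceAt_le_ker (hU : IsOpen U) (hφ : ContDiffOn ℝ (⊤ : ℕ∞) φ U)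
    (hMU : M ∩ U = {y ∈ U | φ y = 0}) {x : E} (hx : x ∈ U) :
    tangentSpaceAt M x ≤ (fderiv ℝ φ x).ker := by
  refine Submodule.span_le.2 ?_
  rintro v ⟨c, hc0, hcv, ε, hε, hcs, hcM⟩
  have hd : DifferentiableAt ℝ φ (c 0) := by
    rw [hc0]
    exact (hφ.contDiffAt (hU.mem_nhds hx)).differentiableAt (by simp)
  have h1 : HasDerivAt (fun t => φ (c t)) (fderiv ℝ φ (c 0) v) 0 :=
    hd.hasFDerivAt.comp_hasDerivAt 0 hcv
  have hev : (fun t => φ (c t)) =ᶠ[𝓝 0] fun _ => 0 := by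
    have h2 : ∀ᶠ t in 𝓝 (0 : ℝ), c t ∈ U :=
      hcv.continuousAt (hU.mem_nhds (by rwa [hc0]))
    filter_upwards [h2, Ioo_mem_nhds (neg_lt_zero.2 hε) hε] with t ht ht'
    have : c t ∈ M ∩ U := ⟨hcM t ht', ht⟩
    rw [hMU] at this
    exact this.2
  have h3 := (hasDerivAt_const (0 : ℝ) (0 : EuclideanSpace ℝ (Fin k))).congr_of_eventuallyEq hev
  rw [hc0] at h1
  exact h1.unique h3

variable [FiniteDimensional ℝ E]

/-- With `L` a right inverse of `A = Dφ(x)`, the map `Φ z = (z - x) + L (φ z - A (z - x))` has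
differential the identity at `x` and satisfies `A ∘ Φ = φ`. It therefore straightens `M` to `ker A`,
and the curve is `t ↦ Φ⁻¹(t v)`. -/
theorem exists_isCurveAt_of_mem_ker (hU : IsOpen U) (hφ : ContDiffOn ℝ (⊤ : ℕ∞) φ U)
    (hMU : M ∩ U = {y ∈ U | φ y = 0}) {x : E} (hxM : x ∈ M) (hx : x ∈ U)
    (hsurj : Function.Surjective (fderiv ℝ φ x)) {v : E} (hv : fderiv ℝ φ x v = 0) :
    ∃ c, IsCurveAt M x c v := by
  set A := fderiv ℝ φ x with hA
  have hφx : φ x = 0 := by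
    have : x ∈ M ∩ U := ⟨hxM, hx⟩
    rw [hMU] at this
    exact this.2
  obtain ⟨L, hL⟩ := A.exists_rightInverse_of_surjective (LinearMap.range_eq_top.2 hsurj)
  have hL' : ∀ a, A (L a) = a := fun a => DFunLike.congr_fun hL a
  set Φ : E → E := fun z => (z - x) + L (φ z - A (z - x)) with hΦ
  have hΦs : ∀ z ∈ U, ContDiffAt ℝ (⊤ : ℕ∞) Φ z := by
    intro z hz
    have := hφ.contDiffAt (hU.mem_nhds hz)
    have hs : ContDiffAt ℝ (⊤ : ℕ∞) (fun z : E => z - x) z := contDiffAt_id.sub contDiffAt_const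
    exact hs.add (L.contDiff.contDiffAt.comp z (this.sub (A.contDiff.contDiffAt.comp z hs)))
  have hΦd : HasFDerivAt Φ ((ContinuousLinearEquiv.refl ℝ E : E ≃L[ℝ] E) : E →L[ℝ] E) x := by
    have h1 : HasFDerivAt φ A x :=
      ((hφ.contDiffAt (hU.mem_nhds hx)).differentiableAt (by simp)).hasFDerivAt
    have h2 : HasFDerivAt (fun z : E => z - x) (ContinuousLinearMap.id ℝ E) x :=
      (hasFDerivAt_id x).sub_const x
    have h3 := h2.add (L.hasFDerivAt.comp x (h1.sub (A.hasFDerivAt.comp x h2)))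
    convert! h3 using 1
    ext w
    simp
  have hn : ((⊤ : ℕ∞) : WithTop ℕ∞) ≠ 0 := by simp
  set e := (hΦs x hx).toOpenPartialHomeomorph Φ hΦd hn with he
  have hecoe : ∀ z, e z = Φ z := fun z => rfl
  have hxs : x ∈ e.source := (hΦs x hx).mem_toOpenPartialHomeomorph_source hΦd hn
  have hΦx : Φ x = 0 := by simp [hΦ, hφx]
  have h0t : (0 : E) ∈ e.target := by
    rw [← hΦx]; exact (hΦs x hx).image_mem_toOpenPartialHomeomorph_target hΦd hn
  have hsymm0 : e.symm 0 = x := by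
    rw [← hΦx, ← hecoe]; exact e.left_inv hxs
  -- The curve must be smooth on a whole interval, so `Φ⁻¹` has to be smooth near `0` and not only
  -- at `0`; invertibility of the differential is an open condition.
  have hinv : {z | z ∈ U ∧ fderiv ℝ Φ z ∈ range ((↑) : (E ≃L[ℝ] E) → E →L[ℝ] E)} ∈ 𝓝 x := by
    have hc : ContinuousAt (fderiv ℝ Φ) x :=
      ((hΦs x hx).fderiv_right (m := 0) (by simp)).continuousAt
    exact inter_mem (hU.mem_nhds hx) (hc.preimage_mem_nhds
      (ContinuousLinearEquiv.isOpen.mem_nhds ⟨_, hΦd.fderiv.symm⟩))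
  have hgood : ∀ᶠ y in 𝓝 (0 : E), y ∈ e.target ∧ e.symm y ∈ U ∧
      ContDiffAt ℝ (⊤ : ℕ∞) e.symm y := by
    have hct : ContinuousAt e.symm 0 := e.continuousAt_symm h0t
    have h4 : ∀ᶠ y in 𝓝 (0 : E), e.symm y ∈
        {z | z ∈ U ∧ fderiv ℝ Φ z ∈ range ((↑) : (E ≃L[ℝ] E) → E →L[ℝ] E)} :=
      hct (by rwa [hsymm0])
    filter_upwards [h4, e.open_target.mem_nhds h0t] with y hy hyt
    obtain ⟨hyU, f', hf'⟩ := hy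
    refine ⟨hyt, hyU, ?_⟩
    have hds : HasFDerivAt Φ (f' : E →L[ℝ] E) (e.symm y) := by
      rw [hf']
      exact ((hΦs _ hyU).differentiableAt (by simp)).hasFDerivAt
    exact e.contDiffAt_symm hyt hds (hΦs _ hyU)
  have hline : Tendsto (fun t : ℝ => t • v) (𝓝 0) (𝓝 (0 : E)) := by
    have : Continuous fun t : ℝ => t • v := by fun_prop
    simpa using this.tendsto 0
  obtain ⟨ε, hε, hball⟩ := Metric.eventually_nhds_iff.1 (hline.eventually hgood)
  have hmem : ∀ t ∈ Ioo (-ε) ε, dist t 0 < ε := fun t ht => by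
    rw [Real.dist_eq, sub_zero]; exact abs_lt.2 ht
  refine ⟨fun t => e.symm (t • v), by simp [hsymm0], ?_, ε, hε, ?_, ?_⟩
  · have hd : HasFDerivAt e.symm (((ContinuousLinearEquiv.refl ℝ E).symm : E ≃L[ℝ] E) : E →L[ℝ] E)
        0 := by
      refine e.hasFDerivAt_symm h0t ?_
      rw [hsymm0]; exact hΦd
    have hd' : HasFDerivAt e.symm (((ContinuousLinearEquiv.refl ℝ E).symm : E ≃L[ℝ] E) : E →L[ℝ] E)
        ((0 : ℝ) • v) := by rwa [zero_smul]
    have hl : HasDerivAt (fun t : ℝ => t • v) v 0 := by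
      simpa using (hasDerivAt_id (0 : ℝ)).smul_const v
    have hcd := hd'.comp_hasDerivAt 0 hl
    simpa [Function.comp_def] using hcd
  · intro t ht
    have := (hball (hmem t ht)).2.2
    have hl : ContDiffAt ℝ (⊤ : ℕ∞) (fun t : ℝ => t • v) t := contDiffAt_id.smul contDiffAt_const
    exact (this.comp t hl).contDiffWithinAt
  · intro t ht
    obtain ⟨h1, h2, -⟩ := hball (hmem t ht)
    have h5 : Φ (e.symm (t • v)) = t • v := e.right_inv h1
    have h6 : φ (e.symm (t • v)) = 0 := by
      have h7 := congrArg A h5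
      simpa [hΦ, hL', hv] using h7
    have : e.symm (t • v) ∈ M ∩ U := by
      rw [hMU]; exact ⟨h2, h6⟩
    exact this.1

theorem adjoint_fderiv_mem_orthogonal (hU : IsOpen U) (hφ : ContDiffOn ℝ (⊤ : ℕ∞) φ U)
    (hMU : M ∩ U = {y ∈ U | φ y = 0}) {x : E} (hx : x ∈ U) (a : EuclideanSpace ℝ (Fin k)) :
    (fderiv ℝ φ x).adjoint a ∈ (tangentSpaceAt M x)ᗮ := by
  rw [Submodule.mem_orthogonal]
  intro u hu
  have : fderiv ℝ φ x u = 0 := tangentSpaceAt_le_ker hU hφ hMU hx hu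
  rw [ContinuousLinearMap.adjoint_inner_right, this, inner_zero_left]

/-- The tangent space contains `ker A`, and `(ker A)ᗮ` is the closure of the range of the adjoint,
already closed in finite dimension. -/
theorem exists_adjoint_eq_of_mem_orthogonal (hU : IsOpen U) (hφ : ContDiffOn ℝ (⊤ : ℕ∞) φ U)
    (hMU : M ∩ U = {y ∈ U | φ y = 0}) {x : E} (hxM : x ∈ M) (hx : x ∈ U)
    (hsurj : Function.Surjective (fderiv ℝ φ x)) {w : E} (hw : w ∈ (tangentSpaceAt M x)ᗮ) :
    ∃ a, (fderiv ℝ φ x).adjoint a = w := by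
  have hle : (fderiv ℝ φ x).ker ≤ tangentSpaceAt M x := fun v hv =>
    Submodule.subset_span (exists_isCurveAt_of_mem_ker hU hφ hMU hxM hx hsurj hv)
  have := Submodule.orthogonal_le hle hw
  rw [ContinuousLinearMap.orthogonal_ker] at this
  rw [Submodule.closed_of_finiteDimensional _ |>.submodule_topologicalClosure_eq] at this
  exact this

/-- A smooth submanifold stays locally within quadratic distance of its tangent spaces. -/
theorem IsSmoothSubmanifold.exists_inner_le_sq (hM : IsSmoothSubmanifold k M) {x : E} (hx : x ∈ M)
    {w : E} (hw : w ∈ (tangentSpaceAt M x)ᗮ) :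
    ∃ L ≥ (0 : ℝ), ∃ ρ > 0, ∀ z ∈ M, ‖z - x‖ < ρ → ⟪w, z - x⟫_ℝ ≤ L * ‖z - x‖ ^ 2 := by
  obtain ⟨U, φ, hU, hxU, hφ, hMU, hs⟩ := hM x hx
  -- With `w = A* a`, the pairing is `⟪a, A (z - x)⟫`, and `φ z = φ x = 0` makes `A (z - x)` minus a
  -- Taylor remainder.
  obtain ⟨a, rfl⟩ := exists_adjoint_eq_of_mem_orthogonal hU hφ hMU hx hxU hs hw
  obtain ⟨K, hK, ρ, hρ, hq⟩ := exists_norm_sub_sub_le_sq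
    ((hφ.contDiffAt (hU.mem_nhds hxU)).of_le (m := 2) (WithTop.coe_le_coe.2 (le_top : (2 : ℕ∞) ≤ ⊤)))
  obtain ⟨ρ', hρ', hb⟩ := Metric.mem_nhds_iff.1 (hU.mem_nhds hxU)
  refine ⟨‖a‖ * K, by positivity, min ρ ρ', lt_min hρ hρ', fun z hz hzx => ?_⟩
  have hzero : ∀ y ∈ M, y ∈ U → φ y = 0 := fun y hy hyU => by
    have : y ∈ M ∩ U := ⟨hy, hyU⟩
    rw [hMU] at this
    exact this.2
  have hzU : z ∈ U := hb (by
    rw [Metric.mem_ball, dist_eq_norm]; exact hzx.trans_le (min_le_right _ _))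
  have h1 := hq z (hzx.trans_le (min_le_left _ _))
  rw [hzero z hz hzU, hzero x hx hxU, sub_zero, zero_sub, norm_neg] at h1
  rw [ContinuousLinearMap.adjoint_inner_left]
  calc _ ≤ ‖a‖ * ‖fderiv ℝ φ x (z - x)‖ := real_inner_le_norm _ _
    _ ≤ ‖a‖ * (K * ‖z - x‖ ^ 2) := by gcongr
    _ = _ := by ring

theorem ContinuousLinearMap.isInvertible_comp_adjoint {F : Type*} [NormedAddCommGroup F]
    [InnerProductSpace ℝ F] [FiniteDimensional ℝ F] {A : E →L[ℝ] F}
    (hA : Function.Surjective A) : (A ∘L A.adjoint).IsInvertible := by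
  have hinj : Function.Injective (A ∘L A.adjoint) := by
    rw [injective_iff_map_eq_zero]
    intro a ha
    have h1 : A.adjoint a = 0 := by
      rw [← inner_self_eq_zero (𝕜 := ℝ), ContinuousLinearMap.adjoint_inner_left]
      have : A (A.adjoint a) = 0 := ha
      rw [this, inner_zero_right]
    obtain ⟨b, rfl⟩ := hA a
    rw [← inner_self_eq_zero (𝕜 := ℝ), ← ContinuousLinearMap.adjoint_inner_left, h1,
      inner_zero_left]
  let e := LinearEquiv.ofInjectiveEndo (A ∘L A.adjoint).toLinearMap hinj
  refine ⟨e.toContinuousLinearEquiv, ?_⟩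
  ext a
  rfl

/-- Near a point of the submanifold, `M` projects onto its tangent spaces along the normal spaces,
locally uniformly. -/
theorem IsSmoothSubmanifold.eventually_exists_sub_mem_orthogonal (hM : IsSmoothSubmanifold k M)
    {x₀ : E} (hx₀ : x₀ ∈ M) {r : ℝ} (hr : 0 < r) :
    ∀ᶠ q : E × E in 𝓝 (0, x₀), q.2 ∈ M →
      ∃ z ∈ M, z - q.2 - q.1 ∈ (tangentSpaceAt M q.2)ᗮ ∧ ‖z - q.2‖ < r := by
  obtain ⟨U, φ, hU, hxU, hφ, hMU, hs⟩ := hM x₀ hx₀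
  set A := fderiv ℝ φ x₀ with hA
  have hφx : φ x₀ = 0 := by
    have : x₀ ∈ M ∩ U := ⟨hx₀, hxU⟩
    rw [hMU] at this
    exact this.2
  -- Solve `φ (x + v + Dφ(x)* a) = 0` for `a` by the implicit function theorem with parameters `(v,
  -- x)`. The partial derivative in `a` at the base point is `A A*`, and keeping `x` as a parameter
  -- gives local uniformity.
  set g : (E × E) × EuclideanSpace ℝ (Fin k) → E :=
    fun q => q.1.2 + q.1.1 + (fderiv ℝ φ q.1.2).adjoint q.2 with hg
  set u : (E × E) × EuclideanSpace ℝ (Fin k) := ((0, x₀), 0) with hu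
  have hφat : ContDiffAt ℝ (⊤ : ℕ∞) φ x₀ := hφ.contDiffAt (hU.mem_nhds hxU)
  have hgu : g u = x₀ := by simp [hg, hu]
  have hgs : ContDiffAt ℝ 1 g u := by
    have h1 : ContDiffAt ℝ 1 (fderiv ℝ φ) u.1.2 :=
      (hφat.of_le (m := 2) (WithTop.coe_le_coe.2 (le_top : (2 : ℕ∞) ≤ ⊤))).fderiv_right
        (by norm_num)
    have h2 : ContDiffAt ℝ 1 (fun q : (E × E) × EuclideanSpace ℝ (Fin k) => q.1.2) u := by
      fun_prop
    have h3 := h1.comp u h2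
    have h4 : ContDiffAt ℝ 1 (fun q : (E × E) × EuclideanSpace ℝ (Fin k) =>
        (ContinuousLinearMap.adjoint (𝕜 := ℝ) (fderiv ℝ φ q.1.2))) u :=
      ((ContinuousLinearMap.adjoint (𝕜 := ℝ) (E := E)
        (F := EuclideanSpace ℝ (Fin k))).toContinuousLinearEquiv.toContinuousLinearMap.contDiff.contDiffAt).comp u h3
    have h5 := h4.clm_apply (contDiffAt_snd (𝕜 := ℝ))
    have h6 : ContDiffAt ℝ 1 (fun q : (E × E) × EuclideanSpace ℝ (Fin k) => q.1.2 + q.1.1) u := by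
      fun_prop
    exact h6.add h5
  have hψs : ContDiffAt ℝ 1 (φ ∘ g) u :=
    ContDiffAt.comp u (by rw [hgu]; exact hφat.of_le (by exact_mod_cast le_top)) hgs
  have hψd : HasStrictFDerivAt (φ ∘ g) (fderiv ℝ (φ ∘ g) u) u :=
    hψs.hasStrictFDerivAt (by norm_num)
  have hpart : fderiv ℝ (φ ∘ g) u ∘L .inr ℝ (E × E) (EuclideanSpace ℝ (Fin k))
      = A ∘L A.adjoint := by
    have h1 : HasFDerivAt (fun a : EuclideanSpace ℝ (Fin k) => ((0, x₀), a) :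
        _ → (E × E) × EuclideanSpace ℝ (Fin k)) (.inr ℝ (E × E) (EuclideanSpace ℝ (Fin k))) 0 :=
      hasFDerivAt_prodMk_right _ _
    have h2 : HasFDerivAt (fun a => φ (g ((0, x₀), a)))
        (fderiv ℝ (φ ∘ g) u ∘L .inr ℝ (E × E) (EuclideanSpace ℝ (Fin k))) 0 :=
      (hψd.hasFDerivAt : HasFDerivAt (φ ∘ g) _ ((0, x₀), 0)).comp 0 h1
    have h3 : HasFDerivAt (fun a : EuclideanSpace ℝ (Fin k) => x₀ + 0 + A.adjoint a)
        A.adjoint 0 := A.adjoint.hasFDerivAt.const_add _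
    have h4 : HasFDerivAt φ A (x₀ + 0 + A.adjoint 0) := by
      simpa using (hφat.differentiableAt (by simp)).hasFDerivAt
    exact h2.unique (h4.comp 0 h3)
  have hinv : (fderiv ℝ (φ ∘ g) u ∘L
      .inr ℝ (E × E) (EuclideanSpace ℝ (Fin k))).IsInvertible := by
    rw [hpart]; exact ContinuousLinearMap.isInvertible_comp_adjoint hs
  set α := hψd.implicitFunctionOfProdDomain hinv with hα
  have hα0 : Tendsto α (𝓝 (0, x₀)) (𝓝 0) := hψd.tendsto_implicitFunctionOfProdDomain hinv
  have hαeq : ∀ᶠ q in 𝓝 ((0, x₀) : E × E), (φ ∘ g) (q, α q) = (φ ∘ g) u :=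
    hψd.eventually_apply_implicitFunctionOfProdDomain hinv
  have hlim : Tendsto (fun q : E × E => g (q, α q)) (𝓝 (0, x₀)) (𝓝 x₀) := by
    have h1 : Tendsto (fun q : E × E => (q, α q)) (𝓝 (0, x₀)) (𝓝 u) := by
      rw [hu, nhds_prod_eq (x := ((0 : E), x₀))]
      exact tendsto_id.prodMk hα0
    have := hgs.continuousAt.tendsto.comp h1
    rwa [hgu] at this
  have hlim2 : Tendsto (fun q : E × E => g (q, α q) - q.2) (𝓝 (0, x₀)) (𝓝 0) := by
    have h2 : Tendsto (fun q : E × E => q.2) (𝓝 (0, x₀)) (𝓝 x₀) :=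
      (continuous_snd.tendsto ((0 : E), x₀))
    simpa using hlim.sub h2
  have hsnd : ∀ᶠ q : E × E in 𝓝 (0, x₀), q.2 ∈ U :=
    (continuous_snd.tendsto ((0 : E), x₀)) (hU.mem_nhds hxU)
  filter_upwards [hαeq, hlim (hU.mem_nhds hxU), hlim2 (Metric.ball_mem_nhds 0 hr), hsnd]
    with q h1 h2 h3 h4 hq
  have h5 : g (q, α q) ∈ M ∩ U := by
    rw [hMU]
    refine ⟨h2, ?_⟩
    have : φ (g (q, α q)) = φ (g u) := h1
    rw [this, hgu, hφx]
  refine ⟨g (q, α q), h5.1, ?_, by simpa using h3⟩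
  have h6 : g (q, α q) - q.2 - q.1 = (fderiv ℝ φ q.2).adjoint (α q) := by
    simp only [hg]; abel
  rw [h6]
  exact adjoint_fderiv_mem_orthogonal hU hφ hMU h4 _

theorem IsSmoothSubmanifold.exists_sub_mem_orthogonal (hM : IsSmoothSubmanifold k M)
    (hc : IsCompact M) {r : ℝ} (hr : 0 < r) :
    ∃ ρ > 0, ∀ x ∈ M, ∀ v, ‖v‖ < ρ →
      ∃ z ∈ M, z - x - v ∈ (tangentSpaceAt M x)ᗮ ∧ ‖z - x‖ < r := by
  have := hc.eventually_forall_of_forall_eventually (x₀ := (0 : E))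
    (P := fun v x => x ∈ M → ∃ z ∈ M, z - x - v ∈ (tangentSpaceAt M x)ᗮ ∧ ‖z - x‖ < r)
    (fun x hx => hM.eventually_exists_sub_mem_orthogonal hx hr)
  obtain ⟨ρ, hρ, h⟩ := Metric.eventually_nhds_iff.1 this
  exact ⟨ρ, hρ, fun x hx v hv => h (by simpa using hv) x hx hx⟩

end LocalDefiningFunction

/-! ### Continuity of the nearest point projection -/

section MetricProjection

variable {E : Type*} [NormedAddCommGroup E] {M : Set E}

theorem IsNearestPt.infDist_eq {s y : E} (h : IsNearestPt M s y) :
    Metric.infDist s M = ‖s - y‖ := by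
  refine le_antisymm ?_ ((Metric.le_infDist ⟨y, h.1⟩).2 fun z hz => ?_)
  · rw [← dist_eq_norm]; exact Metric.infDist_le_dist_of_mem h.1
  · rw [dist_eq_norm]; exact h.2 z hz

theorem IsNearestPt.eq_of_mem {x y : E} (h : IsNearestPt M x y) (hx : x ∈ M) : y = x := by
  have := h.2 x hx
  rw [sub_self, norm_zero, norm_le_zero_iff, sub_eq_zero] at this
  exact this.symm

theorem IsNearestPt.norm_sub_le_two_mul {x s y : E} (h : IsNearestPt M s y) (hx : x ∈ M) :
    ‖y - x‖ ≤ 2 * ‖s - x‖ := by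
  have h1 := h.2 x hx
  have : y - x = (s - x) - (s - y) := by abel
  rw [this]
  refine (norm_sub_le _ _).trans ?_
  linarith

/-- Any cluster point of `P q` as `q → p` is a nearest point of `p`, hence equals `P p`; compactness
of `M` turns this into convergence. -/
theorem ProximallySmooth.continuousAt_proj {R : ℝ} {P : E → E} (hM : IsCompact M)
    (hprox : ProximallySmooth R M)
    (hP : ∀ s, IsNearestPt M s (P s)) {p : E} (hp : Metric.infDist p M < R) :
    ContinuousAt P p := by
  refine hM.tendsto_nhds_of_unique_mapClusterPt (Eventually.of_forall fun q => (hP q).1) ?_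
  intro y hy hcl
  refine (hprox p hp).unique ⟨hy, fun z hz => ?_⟩ (hP p)
  by_contra! hlt
  have hc : Continuous fun w : E × E => ‖w.1 - w.2‖ - ‖w.1 - z‖ := by fun_prop
  have hev : ∀ᶠ w : E × E in 𝓝 (p, y), 0 < ‖w.1 - w.2‖ - ‖w.1 - z‖ :=
    hc.continuousAt.eventually_const_lt (by simpa using hlt)
  rw [nhds_prod_eq, eventually_prod_iff] at hev
  obtain ⟨pa, ha, pb, hb, hab⟩ := hev
  obtain ⟨q, hq1, hq2⟩ := ((mapClusterPt_iff_frequently.1 hcl _ hb).and_eventually ha).exists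
  have := hab hq2 hq1
  have h2 := (hP q).2 z hz
  simp only at this
  linarith

end MetricProjection

/-! ### Enlarging tangent balls, and Federer's inequality -/

section NearestPoint

variable {E : Type*} [NormedAddCommGroup E] [InnerProductSpace ℝ E] {M : Set E} {R : ℝ}

theorem IsNearestPt.sub_mem_orthogonal {s y : E} (h : IsNearestPt M s y) :
    s - y ∈ (tangentSpaceAt M y)ᗮ := by
  rw [Submodule.mem_orthogonal]
  intro u hu
  induction hu using Submodule.span_induction with
  | mem v hv =>
    obtain ⟨c, hc0, hcv, ε, hε, -, hcM⟩ := hv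
    have h1 : HasDerivAt (fun t => ‖s - c t‖ ^ 2) (2 * ⟪s - c 0, 0 - v⟫_ℝ) 0 :=
      ((hasDerivAt_const (0 : ℝ) s).sub hcv).norm_sq
    have h2 : IsLocalMin (fun t => ‖s - c t‖ ^ 2) 0 := by
      filter_upwards [Ioo_mem_nhds (neg_lt_zero.2 hε) hε] with t ht
      have := h.2 _ (hcM t ht)
      rw [hc0]
      gcongr
    have h3 := h2.hasDerivAt_eq_zero h1
    rw [hc0, zero_sub, inner_neg_right] at h3
    rw [real_inner_comm]
    linarith
  | zero => simp
  | add a b _ _ ha hb => rw [inner_add_left, ha, hb, add_zero]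
  | smul a b _ hb => rw [inner_smul_left, hb, mul_zero]

variable {P : E → E}

/-- The distance function to `M` grows at unit speed in the direction away from the nearest
point. -/
theorem ProximallySmooth.exists_eventually_infDist_lt (hM : IsCompact M) (hprox : ProximallySmooth R M)
    (hP : ∀ s, IsNearestPt M s (P s)) {p : E} (hp : Metric.infDist p M < R)
    (hp0 : 0 < Metric.infDist p M) {c : ℝ} (hc1 : c < 1) :
    ∃ e : E, ‖e‖ = 1 ∧ ∀ᶠ h in 𝓝[>] (0 : ℝ),
      Metric.infDist p M + c * h < Metric.infDist (p + h • e) M := by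
  set d := Metric.infDist p M with hd
  have hdP : ‖p - P p‖ = d := (hP p).infDist_eq.symm
  set e : E := d⁻¹ • (p - P p) with he
  have hen : ‖e‖ = 1 := by
    rw [he, norm_smul, hdP, Real.norm_eq_abs, abs_of_pos (inv_pos.2 hp0), inv_mul_cancel₀ hp0.ne']
  have hin : ⟪e, p - P p⟫_ℝ = d := by
    rw [he, real_inner_smul_left, real_inner_self_eq_norm_sq, hdP]
    field_simp
  refine ⟨e, hen, ?_⟩
  have hl : Tendsto (fun h : ℝ => p + h • e) (𝓝 0) (𝓝 p) := by
    have : Continuous fun h : ℝ => p + h • e := by fun_prop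
    simpa using this.tendsto 0
  have hPl : Tendsto (fun h : ℝ => P (p + h • e)) (𝓝 0) (𝓝 (P p)) :=
    (hprox.continuousAt_proj hM hP hp).tendsto.comp hl
  -- The term `h (1 - c²) / 2` is exactly what the comparison of `(d + c h)²` with `‖p - y‖² + 2 h
  -- ⟪e, p - y⟫ + h²` requires.
  have hin' : Tendsto (fun h : ℝ => ⟪e, p - P (p + h • e)⟫_ℝ + h * (1 - c ^ 2) / 2) (𝓝 0)
      (𝓝 (d + 0 * (1 - c ^ 2) / 2)) := by
    rw [← hin]
    refine (tendsto_const_nhds.inner (tendsto_const_nhds.sub hPl)).add ?_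
    have : Continuous fun h : ℝ => h * (1 - c ^ 2) / 2 := by fun_prop
    exact this.tendsto 0
  have hev := hin'.eventually_const_lt (show c * d < d + 0 * (1 - c ^ 2) / 2 by nlinarith)
  filter_upwards [nhdsWithin_le_nhds hev, self_mem_nhdsWithin] with h hh hpos
  have hpos : 0 < h := hpos
  set y := P (p + h • e)
  have h1 : d ≤ ‖p - y‖ := by rw [← hdP]; exact (hP p).2 y (hP _).1
  have h2 : ‖p + h • e - y‖ ^ 2 = ‖p - y‖ ^ 2 + 2 * h * ⟪e, p - y⟫_ℝ + h ^ 2 := by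
    have : p + h • e - y = (p - y) + h • e := by abel
    rw [this, norm_add_sq_real, real_inner_smul_right, norm_smul, hen, real_inner_comm,
      Real.norm_eq_abs, mul_one, sq_abs]
    ring
  rw [(hP (p + h • e)).infDist_eq]
  refine lt_of_pow_lt_pow_left₀ 2 (norm_nonneg _) ?_
  rw [h2]
  nlinarith [mul_pos hpos hp0, mul_self_le_mul_self hp0.le h1]

theorem isNearestPt_add_smul_iff {y w z : E} {s : ℝ} :
    ‖y + s • w - y‖ ≤ ‖y + s • w - z‖ ↔ 2 * s * ⟪w, z - y⟫_ℝ ≤ ‖z - y‖ ^ 2 := by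
  have h1 : y + s • w - z = s • w - (z - y) := by abel
  rw [← pow_le_pow_iff_left₀ (norm_nonneg _) (norm_nonneg _) two_ne_zero, h1,
    norm_sub_sq_real (s • w), add_sub_cancel_left, real_inner_smul_left]
  constructor <;> intro h <;> linarith

variable [FiniteDimensional ℝ E]

/-- Maximize `infDist p M - c ‖p - q‖` over the closed `ε`-ball about `q`. An interior maximizer
could still be moved so that the distance grows faster than rate `c`, so the maximizer lies on the
boundary sphere. -/
theorem ProximallySmooth.exists_le_infDist (hM : IsCompact M) (hprox : ProximallySmooth R M)
    (hP : ∀ s, IsNearestPt M s (P s)) {q : E} (hq : 0 < Metric.infDist q M) {ε : ℝ} (hε : 0 < ε)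
    (hqε : Metric.infDist q M + ε < R) {c : ℝ} (hc0 : 0 < c) (hc1 : c < 1) :
    ∃ p, ‖p - q‖ ≤ ε ∧ Metric.infDist q M + c * ε ≤ Metric.infDist p M := by
  have hcont : Continuous fun p => Metric.infDist p M - c * ‖p - q‖ :=
    (Metric.continuous_infDist_pt M).sub (by fun_prop)
  obtain ⟨p, hp, hmax⟩ := (isCompact_closedBall q ε).exists_isMaxOn
    ⟨q, Metric.mem_closedBall_self hε.le⟩ hcont.continuousOn
  have hpq : ‖p - q‖ ≤ ε := by rwa [← dist_eq_norm]
  have hmaxq : Metric.infDist q M - c * ‖q - q‖ ≤ Metric.infDist p M - c * ‖p - q‖ :=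
    hmax (Metric.mem_closedBall_self hε.le)
  rw [sub_self, norm_zero, mul_zero, sub_zero] at hmaxq
  refine ⟨p, hpq, ?_⟩
  rcases hpq.eq_or_lt with heq | hlt
  · rw [heq] at hmaxq; linarith
  exfalso
  have hpR : Metric.infDist p M < R := by
    have := Metric.infDist_le_infDist_add_dist (s := M) (x := p) (y := q)
    rw [dist_eq_norm] at this
    linarith
  have hp0 : 0 < Metric.infDist p M := by
    have : 0 ≤ c * ‖p - q‖ := by positivity
    linarith
  obtain ⟨e, he, hev⟩ := hprox.exists_eventually_infDist_lt hM hP hpR hp0 hc1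
  have hev2 : ∀ᶠ h in 𝓝[>] (0 : ℝ), h < ε - ‖p - q‖ :=
    nhdsWithin_le_nhds (gt_mem_nhds (sub_pos.2 hlt))
  obtain ⟨h, ⟨h1, h2⟩, h3⟩ := ((hev.and hev2).and self_mem_nhdsWithin).exists
  have h3 : 0 < h := h3
  have hn : ‖p + h • e - q‖ ≤ ‖p - q‖ + h := by
    have : p + h • e - q = (p - q) + h • e := by abel
    rw [this]
    refine (norm_add_le _ _).trans_eq ?_
    rw [norm_smul, he, Real.norm_eq_abs, abs_of_pos h3, mul_one]
  have h4 : Metric.infDist (p + h • e) M - c * ‖p + h • e - q‖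
      ≤ Metric.infDist p M - c * ‖p - q‖ :=
    hmax (by rw [Metric.mem_closedBall, dist_eq_norm]; linarith)
  nlinarith

/-- If `y` is the nearest point to `y + s • w` for some `s > 0`, then it stays so up to the
radius of proximal smoothness. -/
theorem ProximallySmooth.isNearestPt_extend (hM : IsCompact M) (hprox : ProximallySmooth R M)
    (hP : ∀ s, IsNearestPt M s (P s)) {y w : E} (hw : ‖w‖ = 1) {s ε : ℝ} (hs : 0 < s) (hε : 0 < ε)
    (hsε : s + ε < R) (hy : IsNearestPt M (y + s • w) y) :
    IsNearestPt M (y + (s + ε) • w) y := by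
  set q := y + s • w with hq
  have hqy : q - y = s • w := by rw [hq]; abel
  have hdq : Metric.infDist q M = s := by
    rw [hy.infDist_eq, hqy, norm_smul, hw, Real.norm_eq_abs, abs_of_pos hs, mul_one]
  obtain ⟨p, hp, hmax⟩ := (isCompact_closedBall q ε).exists_isMaxOn
    ⟨q, Metric.mem_closedBall_self hε.le⟩ (Metric.continuous_infDist_pt M).continuousOn
  have hpq : ‖p - q‖ ≤ ε := by rwa [← dist_eq_norm]
  have hge : s + ε ≤ Metric.infDist p M := by
    -- The point gaining `c ε` depends on `c`, but the maximizer `p` beats them all, so `c → 1` is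
    -- allowed.
    have hc : ∀ c ∈ Ioo (0 : ℝ) 1, s + c * ε ≤ Metric.infDist p M := by
      intro c hc
      obtain ⟨p', hp', h⟩ := hprox.exists_le_infDist hM hP (q := q) (by rwa [hdq]) hε
        (by rwa [hdq]) hc.1 hc.2
      rw [hdq] at h
      exact h.trans (hmax (by rwa [Metric.mem_closedBall, dist_eq_norm]))
    have hlim : Tendsto (fun c : ℝ => s + c * ε) (𝓝[<] 1) (𝓝 (s + 1 * ε)) := by
      have : Continuous fun c : ℝ => s + c * ε := by fun_prop
      exact (this.tendsto 1).mono_left nhdsWithin_le_nhds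
    rw [one_mul] at hlim
    refine le_of_tendsto hlim ?_
    filter_upwards [Ioo_mem_nhdsLT (zero_lt_one' ℝ)] with c hc' using hc c hc'
  -- Since `‖p - q‖ ≤ ε` and `‖q - y‖ = s`, this is equality in the triangle inequality; it forces
  -- `p - q = ε • w`.
  have hpy : s + ε ≤ ‖(p - q) + s • w‖ := by
    have : (p - q) + s • w = p - y := by rw [hq]; abel
    rw [this, ← dist_eq_norm]
    exact hge.trans (Metric.infDist_le_dist_of_mem hy.1)
  have hsq : (s + ε) ^ 2 ≤ ‖p - q‖ ^ 2 + 2 * s * ⟪p - q, w⟫_ℝ + s ^ 2 := by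
    have h1 : ‖(p - q) + s • w‖ ^ 2 = ‖p - q‖ ^ 2 + 2 * s * ⟪p - q, w⟫_ℝ + s ^ 2 := by
      rw [norm_add_sq_real, real_inner_smul_right, norm_smul, hw, Real.norm_eq_abs, mul_one,
        sq_abs]
      ring
    rw [← h1]
    gcongr
  have hpq2 : ‖p - q‖ ^ 2 ≤ ε ^ 2 := by gcongr
  have hin : ε ≤ ⟪p - q, w⟫_ℝ := by
    by_contra! hlt
    nlinarith
  have hz : ‖(p - q) - ε • w‖ ^ 2 ≤ 0 := by
    rw [norm_sub_sq_real, real_inner_smul_right, norm_smul, hw, Real.norm_eq_abs, mul_one, sq_abs]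
    nlinarith
  have hz' : (p - q) - ε • w = 0 := by
    rw [← norm_eq_zero]
    exact pow_eq_zero_iff (two_ne_zero) |>.1 (le_antisymm hz (by positivity))
  have hpe : p = y + (s + ε) • w := by
    rw [add_smul, ← add_assoc, ← hq, ← sub_eq_iff_eq_add', ← sub_eq_zero]; exact hz'
  refine ⟨hy.1, fun z hz => ?_⟩
  rw [← hpe]
  calc ‖p - y‖ = s + ε := by
        rw [hpe, add_sub_cancel_left, norm_smul, hw, Real.norm_eq_abs, abs_of_pos (by linarith),
          mul_one]
    _ ≤ Metric.infDist p M := hge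
    _ ≤ ‖p - z‖ := by rw [← dist_eq_norm]; exact Metric.infDist_le_dist_of_mem hz

variable {k : ℕ}

/-- The quadratic bound from smoothness makes `y` nearest to `y + s • w` for some small `s`; this
persists for every radius `r < R`, where it says `2 r ⟪w, z - y⟫ ≤ ‖z - y‖²`. Then let `r → R`. -/
theorem ProximallySmooth.inner_le_of_norm_eq_one (hM : IsCompact M) (hS : IsSmoothSubmanifold k M)
    (hR : 0 < R) (hprox : ProximallySmooth R M) (hP : ∀ s, IsNearestPt M s (P s)) {y z w : E}
    (hy : y ∈ M) (hz : z ∈ M) (hwT : w ∈ (tangentSpaceAt M y)ᗮ) (hw : ‖w‖ = 1) :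
    ⟪w, z - y⟫_ℝ ≤ ‖z - y‖ ^ 2 / (2 * R) := by
  obtain ⟨L, hL, ρ, hρ, hloc⟩ := hS.exists_inner_le_sq hy hwT
  -- `2 s L ≤ 1` handles the points within `ρ` of `y`; `2 s ≤ ρ` handles the others by
  -- Cauchy–Schwarz.
  obtain ⟨s, hs, hsR, hsρ, hsL⟩ : ∃ s > 0, s < R ∧ 2 * s ≤ ρ ∧ 2 * s * L ≤ 1 := by
    refine ⟨min (R / 2) (min (ρ / 2) (1 / (2 * (L + 1)))), by positivity, ?_, ?_, ?_⟩
    · exact (min_le_left _ _).trans_lt (by linarith)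
    · have := (min_le_right (R / 2) (min (ρ / 2) (1 / (2 * (L + 1))))).trans (min_le_left _ _)
      linarith
    · have := (min_le_right (R / 2) (min (ρ / 2) (1 / (2 * (L + 1))))).trans (min_le_right _ _)
      rw [le_div_iff₀ (by positivity)] at this
      have h0 : 0 ≤ min (R / 2) (min (ρ / 2) (1 / (2 * (L + 1)))) := by positivity
      nlinarith
  have hnear : IsNearestPt M (y + s • w) y := by
    refine ⟨hy, fun v hv => isNearestPt_add_smul_iff.2 ?_⟩
    rcases lt_or_ge ‖v - y‖ ρ with hlt | hge
    · have h1 := hloc v hv hlt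
      nlinarith [mul_le_mul_of_nonneg_left h1 (by positivity : 0 ≤ 2 * s), sq_nonneg ‖v - y‖]
    · have h1 : ⟪w, v - y⟫_ℝ ≤ ‖v - y‖ := by
        simpa [hw] using real_inner_le_norm w (v - y)
      nlinarith [norm_nonneg (v - y)]
  have hall : ∀ r ∈ Ioo s R, 2 * r * ⟪w, z - y⟫_ℝ ≤ ‖z - y‖ ^ 2 := by
    intro r hr
    have := hprox.isNearestPt_extend hM hP hw hs (sub_pos.2 hr.1) (by simpa using hr.2) hnear
    rw [add_sub_cancel] at this
    exact isNearestPt_add_smul_iff.1 (this.2 z hz)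
  have hlim : Tendsto (fun r : ℝ => 2 * r * ⟪w, z - y⟫_ℝ) (𝓝[<] R) (𝓝 (2 * R * ⟪w, z - y⟫_ℝ)) := by
    have : Continuous fun r : ℝ => 2 * r * ⟪w, z - y⟫_ℝ := by fun_prop
    exact (this.tendsto R).mono_left nhdsWithin_le_nhds
  have := le_of_tendsto hlim (by filter_upwards [Ioo_mem_nhdsLT hsR] with r hr using hall r hr)
  rw [le_div_iff₀ (by positivity)]
  linarith

/-- Federer's inequality: a normal vector makes at most a quadratically small angle with the
chords of `M`. -/
theorem ProximallySmooth.inner_le (hM : IsCompact M) (hS : IsSmoothSubmanifold k M)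
    (hR : 0 < R) (hprox : ProximallySmooth R M) (hP : ∀ s, IsNearestPt M s (P s)) {y z w : E}
    (hy : y ∈ M) (hz : z ∈ M) (hwT : w ∈ (tangentSpaceAt M y)ᗮ) :
    ⟪w, z - y⟫_ℝ ≤ ‖w‖ * (‖z - y‖ ^ 2 / (2 * R)) := by
  rcases eq_or_ne w 0 with rfl | hw0
  · simp
  have hpos : 0 < ‖w‖ := norm_pos_iff.2 hw0
  have h := hprox.inner_le_of_norm_eq_one hM hS hR hP hy hz
    (w := ‖w‖⁻¹ • w) (Submodule.smul_mem _ _ hwT) (by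
      rw [norm_smul, norm_inv, norm_norm, inv_mul_cancel₀ hpos.ne'])
  rw [real_inner_smul_left, inv_mul_le_iff₀ hpos] at h
  exact h

theorem ProximallySmooth.abs_inner_le (hM : IsCompact M) (hS : IsSmoothSubmanifold k M)
    (hR : 0 < R) (hprox : ProximallySmooth R M) (hP : ∀ s, IsNearestPt M s (P s)) {y z w : E}
    (hy : y ∈ M) (hz : z ∈ M) (hwT : w ∈ (tangentSpaceAt M y)ᗮ) :
    |⟪w, z - y⟫_ℝ| ≤ ‖w‖ * (‖z - y‖ ^ 2 / (2 * R)) := by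
  rw [abs_le']
  refine ⟨hprox.inner_le hM hS hR hP hy hz hwT, ?_⟩
  simpa using hprox.inner_le hM hS hR hP hy hz (Submodule.neg_mem _ hwT)

/-- Federer's inequality at both feet, added: with normal vectors of length at most `R / 2` the two
errors total at most half of `‖P s - P s'‖²`, whence the factor `2`. -/
theorem ProximallySmooth.norm_proj_sub_le (hM : IsCompact M) (hS : IsSmoothSubmanifold k M)
    (hR : 0 < R) (hprox : ProximallySmooth R M) (hP : ∀ s, IsNearestPt M s (P s)) {s s' : E}
    (hs : ‖s - P s‖ ≤ R / 2) (hs' : ‖s' - P s'‖ ≤ R / 2) :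
    ‖P s - P s'‖ ≤ 2 * ‖s - s'‖ := by
  have h1 := hprox.inner_le hM hS hR hP (hP s).1 (hP s').1 (hP s).sub_mem_orthogonal
  have h2 := hprox.inner_le hM hS hR hP (hP s').1 (hP s).1 (hP s').sub_mem_orthogonal
  rw [norm_sub_rev (P s')] at h1
  set Δ := P s - P s' with hΔ
  have hq : 0 ≤ ‖Δ‖ ^ 2 / (2 * R) := by positivity
  have h3 : ⟪s - P s, P s' - P s⟫_ℝ ≤ ‖Δ‖ ^ 2 / 4 := by
    refine (h1.trans (mul_le_mul_of_nonneg_right hs hq)).trans_eq ?_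
    field_simp; ring
  have h4 : ⟪s' - P s', Δ⟫_ℝ ≤ ‖Δ‖ ^ 2 / 4 := by
    refine (h2.trans (mul_le_mul_of_nonneg_right hs' hq)).trans_eq ?_
    field_simp; ring
  have h5 : ⟪s - P s, P s' - P s⟫_ℝ + ⟪s' - P s', Δ⟫_ℝ = ‖Δ‖ ^ 2 - ⟪s - s', Δ⟫_ℝ := by
    have e1 : P s' - P s = -Δ := by rw [hΔ]; abel
    have e2 : ⟪s' - P s', Δ⟫_ℝ - ⟪s - P s, Δ⟫_ℝ = ⟪Δ - (s - s'), Δ⟫_ℝ := by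
      rw [← inner_sub_left]; congr 1; rw [hΔ]; abel
    rw [e1, inner_neg_right, neg_add_eq_sub, e2, inner_sub_left, real_inner_self_eq_norm_sq]
  have h6 := real_inner_le_norm (s - s') Δ
  by_contra! hlt
  have hpos : 0 < ‖Δ‖ := (by positivity : 0 ≤ 2 * ‖s - s'‖).trans_lt hlt
  nlinarith

end NearestPoint

/-! ### Lipschitz variation of the tangent spaces -/

section TangentVariation

variable {E : Type*} [NormedAddCommGroup E] [InnerProductSpace ℝ E] [FiniteDimensional ℝ E]
  {M : Set E} {R : ℝ} {P : E → E} {k : ℕ}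

/-- Rescale `t` to `v` of length `δ = ‖z - x‖` and pick `z'` in `M` with `z' = x + v + m`, `m`
normal at `x`. Then `v` is a combination of the chords `z' - z`, `x - z` and of `m`; Federer's
inequality at `z` and at `x` bounds these by `9/2`, `1/2` and `2` times `δ² / R`, in total `7`. -/
theorem ProximallySmooth.exists_inner_le_dist (hM : IsCompact M) (hS : IsSmoothSubmanifold k M)
    (hR : 0 < R) (hprox : ProximallySmooth R M) (hP : ∀ s, IsNearestPt M s (P s)) :
    ∃ ρ > 0, ∀ x ∈ M, ∀ z ∈ M, ‖z - x‖ < ρ → ∀ t ∈ tangentSpaceAt M x, ∀ n ∈ (tangentSpaceAt M z)ᗮ,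
      ⟪n, t⟫_ℝ ≤ 7 / R * ‖z - x‖ * ‖n‖ * ‖t‖ := by
  obtain ⟨ρ, hρ, hsurj⟩ := hS.exists_sub_mem_orthogonal hM hR
  refine ⟨ρ, hρ, fun x hx z hz hzx t ht n hn => ?_⟩
  rcases eq_or_ne t 0 with rfl | ht0
  · simp
  rcases eq_or_ne z x with rfl | hne
  · rw [Submodule.inner_left_of_mem_orthogonal ht hn]; positivity
  have htpos : 0 < ‖t‖ := norm_pos_iff.2 ht0
  set δ := ‖z - x‖ with hδ
  have hδpos : 0 < δ := norm_pos_iff.2 (sub_ne_zero.2 hne)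
  set v := (δ / ‖t‖) • t with hv
  have hvn : ‖v‖ = δ := by
    rw [hv, norm_smul, Real.norm_eq_abs, abs_of_pos (by positivity)]; field_simp
  have hvT : v ∈ tangentSpaceAt M x := Submodule.smul_mem _ _ ht
  obtain ⟨z', hz', hm, hr⟩ := hsurj x hx v (by rwa [hvn])
  set m := z' - x - v with hmdef
  have hm1 : ‖m‖ ≤ ‖z' - x‖ ^ 2 / (2 * R) := by
    have h1 := hprox.inner_le hM hS hR hP hx hz' hm
    have h2 : ⟪m, z' - x⟫_ℝ = ‖m‖ * ‖m‖ := by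
      have : z' - x = m + v := by rw [hmdef]; abel
      rw [this, inner_add_right, Submodule.inner_left_of_mem_orthogonal hvT hm, add_zero,
        real_inner_self_eq_norm_mul_norm]
    rw [h2] at h1
    rcases eq_or_ne m 0 with h0 | h0
    · rw [h0, norm_zero]; positivity
    · exact le_of_mul_le_mul_left h1 (norm_pos_iff.2 h0)
  -- Bootstrap: `‖z' - x‖ < R` gives `‖m‖ ≤ ‖z' - x‖ / 2`, which is absorbed.
  have hzx2 : ‖z' - x‖ ≤ 2 * δ := by
    have h1 : ‖z' - x‖ ≤ ‖m‖ + δ := by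
      have : z' - x = m + v := by rw [hmdef]; abel
      rw [this, ← hvn]; exact norm_add_le _ _
    have h2 : ‖z' - x‖ ^ 2 / (2 * R) ≤ ‖z' - x‖ / 2 := by
      rw [div_le_div_iff₀ (by positivity) (by positivity)]
      nlinarith [norm_nonneg (z' - x)]
    linarith
  have hm2 : ‖m‖ ≤ 2 * δ ^ 2 / R := by
    calc ‖m‖ ≤ _ := hm1
      _ ≤ (2 * δ) ^ 2 / (2 * R) := by gcongr
      _ = _ := by field_simp
  have hz'z : ‖z' - z‖ ≤ 3 * δ := by
    have : z' - z = (z' - x) - (z - x) := by abel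
    rw [this]
    refine (norm_sub_le _ _).trans ?_
    linarith
  have i1 : ⟪n, z' - z⟫_ℝ ≤ ‖n‖ * ((3 * δ) ^ 2 / (2 * R)) :=
    (hprox.inner_le hM hS hR hP hz hz' hn).trans (by gcongr)
  have i2 : -⟪n, x - z⟫_ℝ ≤ ‖n‖ * (δ ^ 2 / (2 * R)) := by
    have := (neg_le_abs _).trans (hprox.abs_inner_le hM hS hR hP hz hx hn)
    rwa [norm_sub_rev x z] at this
  have i3 : -⟪n, m⟫_ℝ ≤ ‖n‖ * (2 * δ ^ 2 / R) :=
    (neg_le_abs _).trans ((abs_real_inner_le_norm _ _).trans (by gcongr))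
  have i4 : ⟪n, v⟫_ℝ = ⟪n, z' - z⟫_ℝ - ⟪n, x - z⟫_ℝ - ⟪n, m⟫_ℝ := by
    rw [← inner_sub_right, ← inner_sub_right]; congr 1; rw [hmdef]; abel
  have i5 : ⟪n, v⟫_ℝ = δ / ‖t‖ * ⟪n, t⟫_ℝ := by rw [hv, real_inner_smul_right]
  have i6 : δ / ‖t‖ * ⟪n, t⟫_ℝ ≤ 7 * δ ^ 2 / R * ‖n‖ := by
    rw [← i5, i4]
    refine (add_le_add (add_le_add i1 i2) i3).trans_eq ?_
    field_simp
    ring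
  rw [div_mul_eq_mul_div, div_le_iff₀ htpos] at i6
  refine le_of_mul_le_mul_left (i6.trans_eq ?_) hδpos
  ring

/-- The form suited to chaining: `t` need not be tangent at `x`, and the errors of successive steps
simply add. -/
theorem ProximallySmooth.exists_norm_sub_starProjection_le (hM : IsCompact M)
    (hS : IsSmoothSubmanifold k M) (hR : 0 < R) (hprox : ProximallySmooth R M)
    (hP : ∀ s, IsNearestPt M s (P s)) :
    ∃ ρ > 0, ∀ x ∈ M, ∀ z ∈ M, ‖z - x‖ < ρ → ∀ t,
      ‖t - (tangentSpaceAt M z).starProjection t‖ ≤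
        ‖t - (tangentSpaceAt M x).starProjection t‖ + 7 / R * ‖z - x‖ * ‖t‖ := by
  obtain ⟨ρ, hρ, h⟩ := hprox.exists_inner_le_dist hM hS hR hP
  refine ⟨ρ, hρ, fun x hx z hz hzx t => ?_⟩
  set n := t - (tangentSpaceAt M z).starProjection t with hn
  set s := (tangentSpaceAt M x).starProjection t with hs
  have hnT : n ∈ (tangentSpaceAt M z)ᗮ := Submodule.sub_starProjection_mem_orthogonal t
  have h1 := h x hx z hz hzx s (Submodule.starProjection_apply_mem _ t) n hnT
  have h2 : ‖n‖ * ‖n‖ = ⟪n, s⟫_ℝ + ⟪n, t - s⟫_ℝ := by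
    rw [← inner_add_right, add_sub_cancel, ← real_inner_self_eq_norm_mul_norm]
    have : t = n + (tangentSpaceAt M z).starProjection t := by rw [hn]; abel
    conv_rhs => rw [this]
    rw [inner_add_right, Submodule.inner_left_of_mem_orthogonal
      (Submodule.starProjection_apply_mem _ t) hnT, add_zero]
  have h3 := real_inner_le_norm n (t - s)
  have h4 : ‖s‖ ≤ ‖t‖ := Submodule.norm_starProjection_apply_le _ t
  rcases eq_or_ne n 0 with h0 | h0
  · rw [h0, norm_zero]; positivity
  refine le_of_mul_le_mul_left ?_ (norm_pos_iff.2 h0)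
  calc ‖n‖ * ‖n‖ ≤ 7 / R * ‖z - x‖ * ‖n‖ * ‖s‖ + ‖n‖ * ‖t - s‖ := by rw [h2]; gcongr
    _ ≤ 7 / R * ‖z - x‖ * ‖n‖ * ‖t‖ + ‖n‖ * ‖t - s‖ := by gcongr
    _ = _ := by ring

/-- The tangent spaces of a proximally smooth submanifold are Lipschitz, with a constant governed
by the radius of proximal smoothness. -/
theorem ProximallySmooth.norm_sub_starProjection_le (hM : IsCompact M)
    (hS : IsSmoothSubmanifold k M) (hR : 0 < R) (hprox : ProximallySmooth R M)
    (hP : ∀ s, IsNearestPt M s (P s)) {x y t : E} (hx : x ∈ M) (hy : y ∈ M) (hxy : ‖y - x‖ ≤ R)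
    (ht : t ∈ tangentSpaceAt M x) :
    ‖t - (tangentSpaceAt M y).starProjection t‖ ≤ 14 / R * ‖y - x‖ * ‖t‖ := by
  obtain ⟨ρ, hρ, hloc⟩ := hprox.exists_norm_sub_starProjection_le hM hS hR hP
  -- The scale `ρ` depends on `M`, so it enters only through the number of steps. The segment from
  -- `x` to `y` stays within `R / 2` of `M`, where projection is 2-Lipschitz; the steps have total
  -- length at most `2 ‖y - x‖`, and `14 = 2 · 7`.
  obtain ⟨N, hN⟩ := exists_nat_gt (2 * ‖y - x‖ / ρ)
  have hN0 : (0 : ℝ) < N := lt_of_le_of_lt (by positivity) hN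
  rw [div_lt_iff₀ hρ] at hN
  set q : ℕ → E := fun i => x + ((i : ℝ) / N) • (y - x) with hq
  have hqd : ∀ i ≤ N, ‖q i - P (q i)‖ ≤ R / 2 := by
    intro i hi
    have hi' : (i : ℝ) / N ≤ 1 := (div_le_one hN0).2 (by exact_mod_cast hi)
    have hi0 : 0 ≤ (i : ℝ) / N := by positivity
    have h1 : ‖q i - x‖ = (i : ℝ) / N * ‖y - x‖ := by
      rw [hq]; simp only [add_sub_cancel_left, norm_smul, Real.norm_eq_abs, abs_of_nonneg hi0]
    have h2 : ‖q i - y‖ = (1 - (i : ℝ) / N) * ‖y - x‖ := by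
      have : q i - y = -((1 - (i : ℝ) / N) • (y - x)) := by
        simp only [hq, sub_smul, one_smul]; abel
      rw [this, norm_neg, norm_smul, Real.norm_eq_abs, abs_of_nonneg (by linarith)]
    have h3 := (hP (q i)).2 x hx
    have h4 := (hP (q i)).2 y hy
    nlinarith
  have hstep : ∀ i, i + 1 ≤ N → ‖P (q (i + 1)) - P (q i)‖ ≤ 2 * ‖y - x‖ / N := by
    intro i hi
    refine (hprox.norm_proj_sub_le hM hS hR hP (hqd _ hi) (hqd i (by omega))).trans_eq ?_
    have : q (i + 1) - q i = (1 / (N : ℝ)) • (y - x) := by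
      simp only [hq]
      rw [add_sub_add_left_eq_sub, ← sub_smul]
      congr 1
      push_cast
      ring
    rw [this, norm_smul, Real.norm_eq_abs, abs_of_pos (by positivity)]
    ring
  have hind : ∀ i ≤ N, ‖t - (tangentSpaceAt M (P (q i))).starProjection t‖ ≤
      i * (7 / R * (2 * ‖y - x‖ / N) * ‖t‖) := by
    intro i
    induction i with
    | zero =>
      intro _
      have h0 : q 0 = x := by simp [hq]
      rw [h0, (hP x).eq_of_mem hx, Submodule.starProjection_eq_self_iff.2 ht]
      simp
    | succ i ih =>
      intro hi
      have h1 := hloc (P (q i)) (hP _).1 (P (q (i + 1))) (hP _).1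
        ((hstep i hi).trans_lt (by rwa [div_lt_iff₀ hN0, mul_comm ρ])) t
      have h2 := ih (by omega)
      have h3 : 7 / R * ‖P (q (i + 1)) - P (q i)‖ * ‖t‖ ≤ 7 / R * (2 * ‖y - x‖ / N) * ‖t‖ := by
        gcongr
        exact hstep i hi
      push_cast
      linarith
  have hqN : q N = y := by simp [hq, div_self hN0.ne']
  have := hind N le_rfl
  rw [hqN, (hP y).eq_of_mem hy] at this
  refine this.trans_eq ?_
  field_simp
  ring

/-- To second order, the nearest point projection moves tangentially like the identity. -/
theorem ProximallySmooth.abs_inner_proj_sub_le (hM : IsCompact M)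
    (hS : IsSmoothSubmanifold k M) (hR : 0 < R) (hprox : ProximallySmooth R M)
    (hP : ∀ s, IsNearestPt M s (P s)) {x t v : E} (hx : x ∈ M) (hv : ‖v‖ ≤ R / 2)
    (ht : t ∈ tangentSpaceAt M x) :
    |⟪t, P (x + v) - x - v⟫_ℝ| ≤ 28 / R * ‖v‖ ^ 2 * ‖t‖ := by
  set y := P (x + v) with hy
  have hyn := hP (x + v)
  have hyx : ‖y - x‖ ≤ 2 * ‖v‖ := by
    simpa using hyn.norm_sub_le_two_mul hx
  have hw : ‖x + v - y‖ ≤ ‖v‖ := by simpa using hyn.2 x hx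
  have h1 := hprox.norm_sub_starProjection_le hM hS hR hP hx hyn.1 (by linarith) ht
  -- The vector `x + v - y` is normal at `y`, so the tangential part of `t` at `y` drops out.
  have h2 : ⟪t, y - x - v⟫_ℝ =
      -⟪t - (tangentSpaceAt M y).starProjection t, x + v - y⟫_ℝ := by
    rw [inner_sub_left, Submodule.inner_right_of_mem_orthogonal
      (Submodule.starProjection_apply_mem _ t) hyn.sub_mem_orthogonal, sub_zero, ← inner_neg_right]
    congr 1; abel
  rw [h2, abs_neg]
  calc _ ≤ ‖t - (tangentSpaceAt M y).starProjection t‖ * ‖x + v - y‖ := abs_real_inner_le_norm _ _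
    _ ≤ (14 / R * (2 * ‖v‖) * ‖t‖) * ‖v‖ := by
      gcongr
      exact h1.trans (by gcongr)
    _ = _ := by ring

end TangentVariation

/-! ### Riemannian gradients and the second order expansion -/

section RiemannianGradient

variable {E : Type*} [NormedAddCommGroup E] [InnerProductSpace ℝ E] [FiniteDimensional ℝ E]
  {M : Set E} {h : E → ℝ} {x : E}

theorem isRiemGrad_starProjection_gradient (hd : DifferentiableAt ℝ h x) :
    IsRiemGrad M h x ((tangentSpaceAt M x).starProjection (∇ h x)) := by
  refine ⟨Submodule.starProjection_apply_mem _ _, fun c v hc => ?_⟩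
  have hvT : v ∈ tangentSpaceAt M x := Submodule.subset_span ⟨c, hc⟩
  have h1 : HasFDerivAt h (InnerProductSpace.toDual ℝ E (∇ h x)) (c 0) := by
    rw [hc.1]; exact hd.hasGradientAt.hasFDerivAt
  have h2 := h1.comp_hasDerivAt 0 hc.2.1
  have h3 : ⟪(tangentSpaceAt M x).starProjection (∇ h x), v⟫_ℝ = ⟪∇ h x, v⟫_ℝ := by
    rw [Submodule.inner_starProjection_left_eq_right, Submodule.starProjection_eq_self_iff.2 hvT]
  rw [h3]
  exact h2

theorem riemGrad_eq_starProjection_gradient (hd : DifferentiableAt ℝ h x) :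
    riemGrad M h x = (tangentSpaceAt M x).starProjection (∇ h x) :=
  (isRiemGrad_starProjection_gradient hd).riemGrad_eq

theorem abs_sub_sub_inner_gradient_le {s : Set E} {l : ℝ} {y : E}
    (hl : 0 ≤ l) (hs : Convex ℝ s) (hd : ∀ z ∈ s, DifferentiableAt ℝ h z)
    (hlip : ∀ z ∈ s, ∀ z' ∈ s, ‖∇ h z - ∇ h z'‖ ≤ l * ‖z - z'‖) (hx : x ∈ s) (hy : y ∈ s) :
    |h y - h x - ⟪∇ h x, y - x⟫_ℝ| ≤ l * ‖y - x‖ ^ 2 := by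
  have hsub : segment ℝ x y ⊆ s := hs.segment_subset hx hy
  have := (convex_segment x y).norm_image_sub_le_of_norm_hasFDerivWithin_le' (f := h)
    (f' := fun z => InnerProductSpace.toDual ℝ E (∇ h z))
    (φ := InnerProductSpace.toDual ℝ E (∇ h x)) (C := l * ‖y - x‖)
    (fun z hz => (hd z (hsub hz)).hasGradientAt.hasFDerivAt.hasFDerivWithinAt)
    (fun z hz => by
      rw [← map_sub, LinearIsometryEquiv.norm_map]
      refine (hlip z (hsub hz) x hx).trans ?_
      gcongr
      rw [segment_eq_image'] at hz
      obtain ⟨θ, hθ, rfl⟩ := hz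
      simp only [add_sub_cancel_left, norm_smul, Real.norm_eq_abs, abs_of_nonneg hθ.1]
      exact mul_le_of_le_one_left (norm_nonneg _) hθ.2)
    (left_mem_segment _ _ _) (right_mem_segment _ _ _)
  rw [Real.norm_eq_abs] at this
  calc _ ≤ _ := this
    _ = _ := by ring

theorem norm_riemGrad_le (hd : DifferentiableAt ℝ h x) : ‖riemGrad M h x‖ ≤ ‖∇ h x‖ := by
  rw [riemGrad_eq_starProjection_gradient hd]
  exact Submodule.norm_starProjection_apply_le _ _

/-- Second order expansion of `h` along the nearest point projection. -/
theorem ProximallySmooth.abs_comp_proj_sub_le {R l χ : ℝ} {P : E → E} {k : ℕ} {v : E}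
    (hM : IsCompact M) (hS : IsSmoothSubmanifold k M) (hR : 0 < R) (hprox : ProximallySmooth R M)
    (hP : ∀ s, IsNearestPt M s (P s)) (hl : 0 ≤ l)
    (hd : ∀ z ∈ convexHull ℝ M, DifferentiableAt ℝ h z)
    (hlip : ∀ z ∈ convexHull ℝ M, ∀ z' ∈ convexHull ℝ M, ‖∇ h z - ∇ h z'‖ ≤ l * ‖z - z'‖)
    (hx : x ∈ M) (hχ : ‖∇ h x‖ ≤ χ) (hv : ‖v‖ ≤ R / 2) :
    |h (P (x + v)) - h x - ⟪riemGrad M h x, v⟫_ℝ| ≤ (4 * l + 30 * χ / R) * ‖v‖ ^ 2 := by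
  have hdx := hd x (subset_convexHull ℝ M hx)
  set y := P (x + v) with hy
  have hyM : y ∈ M := (hP _).1
  have hyx : ‖y - x‖ ≤ 2 * ‖v‖ := by
    simpa using (hP (x + v)).norm_sub_le_two_mul hx
  have hχ0 : 0 ≤ χ := (norm_nonneg _).trans hχ
  set g := riemGrad M h x with hg
  have hgT : g ∈ tangentSpaceAt M x := by
    rw [hg, riemGrad_eq_starProjection_gradient hdx]
    exact Submodule.starProjection_apply_mem _ _
  have hn : ∇ h x - g ∈ (tangentSpaceAt M x)ᗮ := by
    rw [hg, riemGrad_eq_starProjection_gradient hdx]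
    exact Submodule.sub_starProjection_mem_orthogonal _
  have hnn : ‖∇ h x - g‖ ≤ χ := by
    refine le_trans ?_ hχ
    refine le_of_sq_le_sq ?_ (norm_nonneg _)
    have h1 : ∇ h x = (∇ h x - g) + g := by abel
    have h2 : ‖∇ h x‖ ^ 2 = ‖∇ h x - g‖ ^ 2 + ‖g‖ ^ 2 := by
      conv_lhs => rw [h1]
      rw [norm_add_sq_real, Submodule.inner_left_of_mem_orthogonal hgT hn]
      ring
    rw [h2]
    exact le_add_of_nonneg_right (sq_nonneg _)
  have b1 := abs_sub_sub_inner_gradient_le hl (convex_convexHull ℝ M) hd hlip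
    (subset_convexHull ℝ M hx) (subset_convexHull ℝ M hyM)
  have b2 := hprox.abs_inner_le hM hS hR hP hx hyM hn
  have b3 := hprox.abs_inner_proj_sub_le hM hS hR hP hx hv hgT
  have hsq : ‖y - x‖ ^ 2 ≤ 4 * ‖v‖ ^ 2 := by
    calc _ ≤ (2 * ‖v‖) ^ 2 := by gcongr
      _ = _ := by ring
  have b1' : |h y - h x - ⟪∇ h x, y - x⟫_ℝ| ≤ 4 * l * ‖v‖ ^ 2 := by
    refine b1.trans ?_
    calc _ ≤ l * (4 * ‖v‖ ^ 2) := by gcongr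
      _ = _ := by ring
  have b2' : |⟪∇ h x - g, y - x⟫_ℝ| ≤ 2 * χ / R * ‖v‖ ^ 2 := by
    refine b2.trans ?_
    calc _ ≤ χ * (4 * ‖v‖ ^ 2 / (2 * R)) := by gcongr
      _ = _ := by field_simp; ring
  have b3' : |⟪g, y - x - v⟫_ℝ| ≤ 28 * χ / R * ‖v‖ ^ 2 := by
    refine b3.trans ?_
    calc _ ≤ 28 / R * ‖v‖ ^ 2 * χ := by
          gcongr
          exact (norm_riemGrad_le hdx).trans hχ
      _ = _ := by ring
  -- Taylor remainder, normal gradient against the chord, tangential defect of the projection: `4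
  -- l`, `2 χ / R` and `28 χ / R`.
  have hsum : h y - h x - ⟪g, v⟫_ℝ = (h y - h x - ⟪∇ h x, y - x⟫_ℝ)
      + ⟪∇ h x - g, y - x⟫_ℝ + ⟪g, y - x - v⟫_ℝ := by
    rw [inner_sub_left, inner_sub_right g (y - x) v]; ring
  rw [hsum]
  refine (abs_add_three _ _ _).trans ?_
  refine (add_le_add (add_le_add b1' b2') b3').trans_eq ?_
  ring

end RiemannianGradient

/-! ### Second moments and rotation invariance on the sphere -/

section SphereMoments

open scoped Pointwise

variable {E : Type*} [NormedAddCommGroup E] [InnerProductSpace ℝ E] [FiniteDimensional ℝ E]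
  [MeasurableSpace E] [BorelSpace E]

/-- The second moments of a rotation invariant probability measure on the unit sphere. -/
theorem integral_inner_smul_of_map_eq {ν : Measure E} [IsProbabilityMeasure ν]
    (hν : ∀ L : E ≃ₗᵢ[ℝ] E, ν.map L = ν) (hnorm : ∀ᵐ u ∂ν, ‖u‖ = 1) (g : E) :
    ∫ u, ⟪g, u⟫_ℝ • u ∂ν = (Module.finrank ℝ E : ℝ)⁻¹ • g := by
  set A : E → E := fun g => ∫ u, ⟪g, u⟫_ℝ • u ∂ν with hA
  have hint : ∀ g : E, Integrable (fun u => ⟪g, u⟫_ℝ • u) ν := by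
    intro g
    refine Integrable.of_bound (C := ‖g‖) (by fun_prop) ?_
    filter_upwards [hnorm] with u hu
    rw [norm_smul, hu, mul_one, Real.norm_eq_abs]
    simpa [hu] using abs_real_inner_le_norm g u
  have hcomm : ∀ (L : E ≃ₗᵢ[ℝ] E) (g : E), L (A g) = A (L g) := by
    intro L g
    have h1 : A (L g) = ∫ u, ⟪L g, u⟫_ℝ • u ∂(ν.map L) := by rw [hν L]
    rw [h1, integral_map L.continuous.measurable.aemeasurable (by fun_prop)]
    have h2 : L (A g) = ∫ u, L (⟪g, u⟫_ℝ • u) ∂ν :=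
      ((L.toContinuousLinearEquiv.toContinuousLinearMap).integral_comp_comm (hint g)).symm
    rw [h2]
    refine integral_congr_ae (Eventually.of_forall fun u => ?_)
    simp [LinearIsometryEquiv.inner_map_map]
  have hself : ∀ g, ⟪g, A g⟫_ℝ = ∫ u, ⟪g, u⟫_ℝ ^ 2 ∂ν := by
    intro g
    rw [hA, ← integral_inner (hint g)]
    refine integral_congr_ae (Eventually.of_forall fun u => ?_)
    simp only [real_inner_smul_right]
    ring
  -- A reflection carries `a` to `b` and commutes with `A`.
  have heq : ∀ a b : E, ‖a‖ = 1 → ‖b‖ = 1 → ⟪a, A a⟫_ℝ = ⟪b, A b⟫_ℝ := by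
    intro a b ha hb
    have h1 : (Submodule.span ℝ {a - b})ᗮ.reflection a = b :=
      Submodule.reflection_sub (ha.trans hb.symm)
    rw [← h1, ← hcomm, LinearIsometryEquiv.inner_map_map]
  have hunit : ∀ g : E, ‖g‖ = 1 → A g = (Module.finrank ℝ E : ℝ)⁻¹ • g := by
    intro g hg
    -- Reflection in the line of `g` fixes `g`, hence `A g`; its fixed vectors form that line. The
    -- eigenvalue then comes from the trace of `A`, which is the mean of `‖u‖² = 1`.
    have h1 : A g ∈ Submodule.span ℝ {g} := by
      rw [← Submodule.reflection_eq_self_iff, hcomm, (Submodule.reflection_eq_self_iff g).2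
        (Submodule.mem_span_singleton_self g)]
    obtain ⟨c, hc⟩ := Submodule.mem_span_singleton.1 h1
    let b := stdOrthonormalBasis ℝ E
    have h2 : ∑ i, ⟪b i, A (b i)⟫_ℝ = 1 := by
      simp_rw [hself]
      rw [← integral_finsetSum]
      · have : ∀ᵐ u ∂ν, ∑ i, ⟪b i, u⟫_ℝ ^ 2 = 1 := by
          filter_upwards [hnorm] with u hu
          rw [b.sum_sq_inner_right, hu, one_pow]
        rw [integral_congr_ae this]
        simp
      · intro i _
        refine Integrable.of_bound (C := 1) (by fun_prop) ?_
        filter_upwards [hnorm] with u hu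
        rw [norm_pow, Real.norm_eq_abs]
        have := abs_real_inner_le_norm (b i) u
        rw [hu, b.norm_eq_one, mul_one] at this
        exact pow_le_one₀ (abs_nonneg _) this
    have h3 : ∀ i, ⟪b i, A (b i)⟫_ℝ = c := by
      intro i
      rw [heq _ g (b.norm_eq_one i) hg, ← hc, real_inner_smul_right, real_inner_self_eq_norm_sq,
        hg]
      ring
    simp_rw [h3] at h2
    rw [Finset.sum_const, Finset.card_univ, Fintype.card_fin, nsmul_eq_mul] at h2
    rw [← hc, eq_inv_of_mul_eq_one_right h2]
  change A g = _
  rcases eq_or_ne g 0 with rfl | hg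
  · simp [hA]
  have hpos : ‖g‖ ≠ 0 := norm_ne_zero_iff.2 hg
  have h1 := hunit (‖g‖⁻¹ • g) (by rw [norm_smul, norm_inv, norm_norm, inv_mul_cancel₀ hpos])
  have h2 : A (‖g‖⁻¹ • g) = ‖g‖⁻¹ • A g := by
    simp only [hA, real_inner_smul_left, mul_smul]
    rw [integral_smul]
  rw [h2, smul_comm] at h1
  exact smul_right_injective E (inv_ne_zero hpos) h1

/-- `toSphere` measures a set through the volume of the cone over it; `L` commutes with forming
cones and preserves volume. -/
theorem MeasureTheory.Measure.map_toSphere_map_linearIsometryEquiv (L : E ≃ₗᵢ[ℝ] E) :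
    ((volume : Measure E).toSphere.map Subtype.val).map L =
      (volume : Measure E).toSphere.map Subtype.val := by
  have hL : Measurable L := L.continuous.measurable
  ext s hs
  rw [Measure.map_apply hL hs, Measure.map_apply measurable_subtype_coe (hL hs),
    Measure.map_apply measurable_subtype_coe hs,
    Measure.toSphere_apply' _ (measurable_subtype_coe (hL hs)),
    Measure.toSphere_apply' _ (measurable_subtype_coe hs),
    Subtype.image_preimage_coe, Subtype.image_preimage_coe]
  congr 1
  have h1 : Ioo (0 : ℝ) 1 • (Metric.sphere (0 : E) 1 ∩ L ⁻¹' s) =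
      L ⁻¹' (Ioo (0 : ℝ) 1 • (Metric.sphere (0 : E) 1 ∩ s)) := by
    ext y
    simp only [Set.mem_smul, mem_inter_iff, mem_preimage, mem_sphere_zero_iff_norm]
    constructor
    · rintro ⟨t, ht, z, ⟨hz, hzs⟩, rfl⟩
      exact ⟨t, ht, L z, ⟨by simpa using hz, hzs⟩, by simp⟩
    · rintro ⟨t, ht, z, ⟨hz, hzs⟩, hy⟩
      refine ⟨t, ht, L.symm z, ⟨by simpa using hz, by simpa using hzs⟩, ?_⟩
      rw [← L.symm_apply_apply y, ← hy]; simp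
  rw [h1]
  exact (L.measurePreserving).measure_preimage_emb L.toHomeomorph.measurableEmbedding _

end SphereMoments

section SphereUniform

variable {p r : ℕ}

theorem map_sphereUniform (L : MatSpace p r ≃ₗᵢ[ℝ] MatSpace p r) :
    (sphereUniform p r).map L = sphereUniform p r := by
  rw [sphereUniform, Measure.map_smul, Measure.map_smul,
    Measure.map_toSphere_map_linearIsometryEquiv]

theorem ae_norm_eq_one_sphereUniform : ∀ᵐ u ∂sphereUniform p r, ‖u‖ = 1 := by
  rw [sphereUniform, ae_map_iff measurable_subtype_coe.aemeasurable
    (measurableSet_eq_fun measurable_norm measurable_const)]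
  exact Eventually.of_forall fun u => by simp

theorem integral_inner_smul_sphereUniform [IsProbabilityMeasure (sphereUniform p r)]
    (g : MatSpace p r) :
    ∫ u, ⟪g, u⟫_ℝ • u ∂sphereUniform p r = (p * r : ℝ)⁻¹ • g := by
  rw [integral_inner_smul_of_map_eq map_sphereUniform ae_norm_eq_one_sphereUniform]
  simp

end SphereUniform

/-- A function of two variables that is measurable in one and continuous in the other is jointly
measurable, up to null sets. -/
theorem aestronglyMeasurable_uncurry_comp_of_continuousOn {X S E : Type*} [MeasurableSpace X]
    [MeasurableSpace S] [PseudoMetricSpace E] [MeasurableSpace E] [BorelSpace E] {ν : Measure X}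
    {D : Measure S} [SFinite ν] [SFinite D] {M : Set E} [TopologicalSpace.SeparableSpace M] {F : E → S → ℝ}
    (hF : ∀ y, AEStronglyMeasurable (F y) D)
    (hcont : ∀ᵐ ξ ∂D, ContinuousOn (fun y => F y ξ) M) {Y : X → E} (hY : Measurable Y)
    (hYM : ∀ a, Y a ∈ M) :
    AEStronglyMeasurable (fun q : X × S => F (Y q.1) q.2) (ν.prod D) := by
  rcases isEmpty_or_nonempty X with hX | ⟨⟨a₀⟩⟩
  · exact (StronglyMeasurable.of_subsingleton_dom).aestronglyMeasurable
  -- Approximate `Y` by simple functions with values in `M`: for each, `F (φ n ·) ·` is a finite sum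
  -- of measurable pieces, and continuity on `M` gives the limit.
  set φ := SimpleFunc.approxOn Y hY M (Y a₀) (hYM a₀) with hφ
  have hmeas : ∀ n, AEStronglyMeasurable (fun q : X × S => F (φ n q.1) q.2) (ν.prod D) := by
    intro n
    have heq : (fun q : X × S => F (φ n q.1) q.2) = fun q =>
        ∑ y ∈ (φ n).range, (Prod.fst ⁻¹' (φ n ⁻¹' {y})).indicator (fun a => F y a.2) q := by
      ext q
      rw [Finset.sum_eq_single (φ n q.1)]
      · exact (indicator_of_mem (s := Prod.fst ⁻¹' (φ n ⁻¹' {φ n q.1})) rfl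
          fun a : X × S => F (φ n q.1) a.2).symm
      · intro y _ hy
        exact indicator_of_notMem (s := Prod.fst ⁻¹' (φ n ⁻¹' {y})) (a := q)
          (fun h => hy (h : φ n q.1 = y).symm) fun a : X × S => F y a.2
      · intro h
        exact absurd (SimpleFunc.mem_range_self _ _) h
    rw [heq]
    refine Finset.aestronglyMeasurable_fun_sum _ fun y _ => ?_
    exact ((hF y).comp_snd).indicator (measurable_fst ((φ n).measurableSet_preimage {y}))
  refine aestronglyMeasurable_of_tendsto_ae atTop hmeas ?_
  filter_upwards [Measure.quasiMeasurePreserving_snd.ae hcont] with q hq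
  have h1 : Tendsto (fun n => φ n q.1) atTop (𝓝[M] (Y q.1)) :=
    tendsto_nhdsWithin_iff.2 ⟨SimpleFunc.tendsto_approxOn hY _ (subset_closure (hYM _)),
      Eventually.of_forall fun n => SimpleFunc.approxOn_mem hY _ n _⟩
  exact (hq _ (hYM _)).tendsto.comp h1

/-! ### Mean and integrability of a single summand -/

section Estimator

variable {E S : Type*} [NormedAddCommGroup E] [InnerProductSpace ℝ E] [FiniteDimensional ℝ E]
  [MeasurableSpace S] {M : Set E} {P : E → E} {F : E → S → ℝ}
  {f : E → ℝ} {σ l χ R μ : ℝ} {k : ℕ} {D : Measure S} {x : E}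

/-- The exceptional null set of `ξ` does not depend on `v`, so the bound can be used with a random
direction. -/
theorem SmoothOracle.ae_abs_comp_proj_sub_le (hM : IsCompact M) (hS : IsSmoothSubmanifold k M)
    (hR : 0 < R) (hprox : ProximallySmooth R M) (hP : ∀ s, IsNearestPt M s (P s)) (hl : 0 ≤ l)
    (hF : SmoothOracle M D F l χ) (hx : x ∈ M) :
    ∀ᵐ ξ ∂D, ∀ v, ‖v‖ ≤ R / 2 →
      |F (P (x + v)) ξ - F x ξ - ⟪riemGrad M (fun y => F y ξ) x, v⟫_ℝ| ≤
        (4 * l + 30 * χ / R) * ‖v‖ ^ 2 := by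
  filter_upwards [hF.grad_bound, hF.differentiable, hF.grad_lipschitz] with ξ h1 h2 h3 v hv
  exact hprox.abs_comp_proj_sub_le hM hS hR hP hl h2 h3 hx (h1 x hx) hv

variable [IsProbabilityMeasure D]

theorem UnbiasedOracle.abs_comp_proj_sub_le (hM : IsCompact M) (hS : IsSmoothSubmanifold k M)
    (hR : 0 < R) (hprox : ProximallySmooth R M) (hP : ∀ s, IsNearestPt M s (P s)) (hl : 0 ≤ l)
    (hf : UnbiasedOracle M D F f σ) (hF : SmoothOracle M D F l χ) (hx : x ∈ M) {v : E}
    (hv : ‖v‖ ≤ R / 2) :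
    |f (P (x + v)) - f x - ⟪riemGrad M f x, v⟫_ℝ| ≤ (4 * l + 30 * χ / R) * ‖v‖ ^ 2 := by
  have hgi := hf.grad_integrable x hx
  have hin : ∫ ξ, ⟪riemGrad M (fun y => F y ξ) x, v⟫_ℝ ∂D = ⟪riemGrad M f x, v⟫_ℝ := by
    rw [← hf.grad_mean_eq x hx, real_inner_comm, ← integral_inner hgi]
    simp_rw [real_inner_comm]
  have heq : f (P (x + v)) - f x - ⟪riemGrad M f x, v⟫_ℝ =
      ∫ ξ, (F (P (x + v)) ξ - F x ξ - ⟪riemGrad M (fun y => F y ξ) x, v⟫_ℝ) ∂D := by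
    have hsub : Integrable (fun ξ => F (P (x + v)) ξ - F x ξ) D :=
      (hf.integrable _).sub (hf.integrable _)
    rw [integral_sub hsub (hgi.inner_const v),
      integral_sub (hf.integrable _) (hf.integrable _), hf.mean_eq, hf.mean_eq, hin]
  rw [heq, ← Real.norm_eq_abs]
  refine (norm_integral_le_of_norm_le_const (C := (4 * l + 30 * χ / R) * ‖v‖ ^ 2) ?_).trans_eq
    (by simp)
  filter_upwards [hF.ae_abs_comp_proj_sub_le hM hS hR hprox hP hl hx] with ξ h using h v hv

variable [MeasurableSpace E] [BorelSpace E] {ν : Measure E} [IsProbabilityMeasure ν]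

theorem SmoothOracle.aestronglyMeasurable_comp_proj (hM : IsCompact M)
    (hprox : ProximallySmooth R M) (hP : ∀ s, IsNearestPt M s (P s))
    (hf : UnbiasedOracle M D F f σ) (hF : SmoothOracle M D F l χ) (hx : x ∈ M)
    (hμ : 0 < μ) (hμR : μ < R) (hν : ∀ᵐ u ∂ν, ‖u‖ = 1) :
    AEStronglyMeasurable (fun q : E × S => F (P (x + μ • q.1)) q.2) (ν.prod D) := by
  classical
  have hPc : ContinuousOn (fun u : E => P (x + μ • u)) (Metric.sphere 0 1) := by
    intro u hu
    have hlt : Metric.infDist (x + μ • u) M < R := by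
      refine (Metric.infDist_le_dist_of_mem hx).trans_lt ?_
      rw [dist_eq_norm, add_sub_cancel_left, norm_smul, mem_sphere_zero_iff_norm.1 hu, mul_one,
        Real.norm_eq_abs, abs_of_pos hμ]
      exact hμR
    have h1 : ContinuousAt (fun u : E => x + μ • u) u := by fun_prop
    exact (ContinuousAt.comp (f := fun u : E => x + μ • u)
      (hprox.continuousAt_proj hM hP hlt) h1).continuousWithinAt
  -- `P` is an arbitrary choice away from `M` and may fail to be measurable there; only its values
  -- over the unit sphere matter.
  set Y : E → E := (Metric.sphere (0 : E) 1).piecewise (fun u => P (x + μ • u)) fun _ => x with hY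
  have hYm : Measurable Y :=
    hPc.measurable_piecewise continuousOn_const Metric.isClosed_sphere.measurableSet
  have hYM : ∀ u, Y u ∈ M := by
    intro u
    by_cases hu : u ∈ Metric.sphere (0 : E) 1
    · rw [hY, piecewise_eq_of_mem _ _ _ hu]; exact (hP _).1
    · rw [hY, piecewise_eq_of_notMem _ _ _ hu]; exact hx
  have hcont : ∀ᵐ ξ ∂D, ContinuousOn (fun y => F y ξ) M := by
    filter_upwards [hF.differentiable] with ξ hξ y hy
    exact (hξ y (subset_convexHull ℝ M hy)).continuousAt.continuousWithinAt
  refine (aestronglyMeasurable_uncurry_comp_of_continuousOn (ν := ν)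
    (fun y => (hf.integrable y).aestronglyMeasurable) hcont hYm hYM).congr ?_
  filter_upwards [Measure.quasiMeasurePreserving_fst.ae hν] with q hq
  have : Y q.1 = P (x + μ • q.1) :=
    piecewise_eq_of_mem _ _ _ (mem_sphere_zero_iff_norm.2 hq)
  rw [this]

theorem SmoothOracle.integrable_difference_smul (hM : IsCompact M) (hS : IsSmoothSubmanifold k M)
    (hR : 0 < R) (hprox : ProximallySmooth R M) (hP : ∀ s, IsNearestPt M s (P s)) (hl : 0 ≤ l)
    (hf : UnbiasedOracle M D F f σ) (hF : SmoothOracle M D F l χ) (hx : x ∈ M)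
    (hμ : 0 < μ) (hμR : μ ≤ R / 2) (hν : ∀ᵐ u ∂ν, ‖u‖ = 1) :
    Integrable (fun q : E × S => ((F (P (x + μ • q.1)) q.2 - F x q.2) / μ) • q.1) (ν.prod D) := by
  have hm := hF.aestronglyMeasurable_comp_proj (ν := ν) hM hprox hP hf hx hμ (by linarith) hν
  have hm2 : AEStronglyMeasurable (fun q : E × S => F x q.2) (ν.prod D) :=
    (hf.integrable x).aestronglyMeasurable.comp_snd
  have hm3 : AEStronglyMeasurable
      (fun q : E × S => ((F (P (x + μ • q.1)) q.2 - F x q.2) / μ) • q.1) (ν.prod D) := by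
    simp_rw [div_eq_inv_mul]
    exact ((hm.sub hm2).const_mul _).smul measurable_fst.aestronglyMeasurable
  refine Integrable.of_bound (C := ((4 * l + 30 * χ / R) * μ ^ 2 + χ * μ) / μ) hm3 ?_
  have hgrad : ∀ᵐ ξ ∂D, ‖riemGrad M (fun y => F y ξ) x‖ ≤ χ := by
    filter_upwards [hF.grad_bound, hF.differentiable] with ξ h1 h2
    exact (norm_riemGrad_le (h2 x (subset_convexHull ℝ M hx))).trans (h1 x hx)
  filter_upwards [Measure.quasiMeasurePreserving_fst.ae hν,
    Measure.quasiMeasurePreserving_snd.ae (hF.ae_abs_comp_proj_sub_le hM hS hR hprox hP hl hx),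
    Measure.quasiMeasurePreserving_snd.ae hgrad] with q h1 h2 h3
  have hn : ‖μ • q.1‖ = μ := by
    rw [norm_smul, h1, mul_one, Real.norm_eq_abs, abs_of_pos hμ]
  have h4 := h2 (μ • q.1) (by rwa [hn])
  rw [hn] at h4
  have h5 := abs_real_inner_le_norm (riemGrad M (fun y => F y q.2) x) (μ • q.1)
  rw [hn] at h5
  have h6 : ‖riemGrad M (fun y => F y q.2) x‖ * μ ≤ χ * μ := by gcongr
  rw [norm_smul, h1, mul_one, norm_div, Real.norm_eq_abs, Real.norm_eq_abs, abs_of_pos hμ]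
  gcongr
  rw [abs_le] at h4 h5 ⊢
  constructor <;> linarith

/-- By Fubini, averaging over `ξ` first replaces `F` by `f`; the expansion of `f` along the
projection, divided by `μ`, then bounds the integrand in `u`. -/
theorem UnbiasedOracle.norm_integral_difference_smul_sub_le (hM : IsCompact M)
    (hS : IsSmoothSubmanifold k M) (hR : 0 < R) (hprox : ProximallySmooth R M)
    (hP : ∀ s, IsNearestPt M s (P s)) (hl : 0 ≤ l) (hf : UnbiasedOracle M D F f σ)
    (hF : SmoothOracle M D F l χ) (hx : x ∈ M) (hμ : 0 < μ) (hμR : μ ≤ R / 2)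
    (hν : ∀ᵐ u ∂ν, ‖u‖ = 1) :
    ‖(∫ q : E × S, ((F (P (x + μ • q.1)) q.2 - F x q.2) / μ) • q.1 ∂ν.prod D) -
      ∫ u, ⟪riemGrad M f x, u⟫_ℝ • u ∂ν‖ ≤ (4 * l + 30 * χ / R) * μ := by
  have hi := hF.integrable_difference_smul (ν := ν) hM hS hR hprox hP hl hf hx hμ hμR hν
  have hi2 : Integrable (fun u : E => ⟪riemGrad M f x, u⟫_ℝ • u) ν := by
    refine Integrable.of_bound (C := ‖riemGrad M f x‖) (by fun_prop) ?_
    filter_upwards [hν] with u hu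
    rw [norm_smul, hu, mul_one, Real.norm_eq_abs]
    simpa [hu] using abs_real_inner_le_norm (riemGrad M f x) u
  rw [integral_prod _ hi, ← integral_sub hi.integral_prod_left hi2]
  refine (norm_integral_le_of_norm_le_const (C := (4 * l + 30 * χ / R) * μ) ?_).trans_eq (by simp)
  filter_upwards [hν] with u hu
  have hn : ‖μ • u‖ = μ := by
    rw [norm_smul, hu, mul_one, Real.norm_eq_abs, abs_of_pos hμ]
  have h1 : ∫ ξ, ((F (P (x + μ • u)) ξ - F x ξ) / μ) • u ∂D =
      ((f (P (x + μ • u)) - f x) / μ) • u := by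
    rw [integral_smul_const, integral_div, integral_sub (hf.integrable _) (hf.integrable _),
      hf.mean_eq, hf.mean_eq]
  have h2 := hf.abs_comp_proj_sub_le hM hS hR hprox hP hl hF hx (v := μ • u) (by rwa [hn])
  rw [hn, real_inner_smul_right] at h2
  rw [h1, ← sub_smul, norm_smul, hu, mul_one, Real.norm_eq_abs]
  have h3 : (f (P (x + μ • u)) - f x) / μ - ⟪riemGrad M f x, u⟫_ℝ =
      (f (P (x + μ • u)) - f x - μ * ⟪riemGrad M f x, u⟫_ℝ) / μ := by field_simp
  rw [h3, abs_div, abs_of_pos hμ, div_le_iff₀ hμ]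
  exact h2.trans_eq (by ring)

end Estimator

/-! ### The bias bound -/

theorem lemma3p3 (γ l χ : ℝ) (hγ : 0 < γ) (hl : 0 ≤ l) (hχ : 0 ≤ χ) :
    ∃ C : ℝ, ∀ (p r : ℕ) (k : ℕ) (M : Set (MatSpace p r)),
      IsCompact M → IsSmoothSubmanifold k M → ProximallySmooth (2 * γ) M →
      ∀ P : MatSpace p r → MatSpace p r, (∀ s, IsNearestPt M s (P s)) →
      ∀ (S : Type*) [MeasurableSpace S] (D : Measure S) [IsProbabilityMeasure D]
        (F : MatSpace p r → S → ℝ) (f : MatSpace p r → ℝ) (σ : ℝ),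
      UnbiasedOracle M D F f σ → SmoothOracle M D F l χ →
      ∀ (m : ℕ), 0 < m →
      ∀ (Ω : Type*) [MeasurableSpace Ω] (Pr : Measure Ω) [IsProbabilityMeasure Pr]
        (u : Fin m → Ω → MatSpace p r) (ξ : Fin m → Ω → S),
      (∀ j, HasLaw (u j) (sphereUniform p r) Pr) → (∀ j, HasLaw (ξ j) D Pr) →
      iIndepFun u Pr → iIndepFun ξ Pr →
      IndepFun (fun ω j => u j ω) (fun ω j => ξ j ω) Pr →
      ∀ x ∈ M, ∀ μ : ℝ, 0 < μ → μ ≤ γ →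
        Integrable (fun ω => projEstimator P F μ x (fun j => u j ω) (fun j => ξ j ω)) Pr ∧
        ‖(∫ ω, projEstimator P F μ x (fun j => u j ω) (fun j => ξ j ω) ∂Pr) - riemGrad M f x‖
          ≤ (C * (p * r)) * μ := by

  -- The constant of the second order expansion at `R = 2γ`; the condition `μ ≤ γ` is `μ ≤ R / 2`.
  refine ⟨4 * l + 30 * χ / (2 * γ), ?_⟩
  intro p r k M hM hS hprox P hP S _ D _ F f σ hf hF m hm Ω _ Pr _ u ξ hu hξ _ _ hind x hx μ hμ hμγ
  have hR : 0 < 2 * γ := by positivity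
  have hμR : μ ≤ 2 * γ / 2 := by linarith
  have hprob : IsProbabilityMeasure (sphereUniform p r) :=
    ((hu ⟨0, hm⟩).isProbabilityMeasure_iff).1 inferInstance
  set Z : MatSpace p r × S → MatSpace p r :=
    fun q => ((F (P (x + μ • q.1)) q.2 - F x q.2) / μ) • q.1 with hZ
  have hi : Integrable Z ((sphereUniform p r).prod D) :=
    hF.integrable_difference_smul hM hS hR hprox hP hl hf hx hμ hμR ae_norm_eq_one_sphereUniform
  have hlaw : ∀ j, HasLaw (fun ω => (u j ω, ξ j ω)) ((sphereUniform p r).prod D) Pr := fun j =>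
    (hind.comp (measurable_pi_apply j) (measurable_pi_apply j)).hasLaw_prod (hu j) (hξ j)
  have hij : ∀ j, Integrable (fun ω => Z (u j ω, ξ j ω)) Pr := by
    intro j
    have h1 : Integrable Z (Pr.map fun ω => (u j ω, ξ j ω)) := by rwa [(hlaw j).map_eq]
    exact h1.comp_aemeasurable (hlaw j).aemeasurable
  have hIj : ∀ j, ∫ ω, Z (u j ω, ξ j ω) ∂Pr = ∫ q, Z q ∂(sphereUniform p r).prod D := fun j =>
    (hlaw j).integral_comp hi.aestronglyMeasurable
  have hG : (fun ω => projEstimator P F μ x (fun j => u j ω) (fun j => ξ j ω)) =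
      fun ω => ((p * r : ℝ) / m) • ∑ j, Z (u j ω, ξ j ω) := rfl
  rw [hG]
  refine ⟨(integrable_finsetSum _ fun j _ => hij j).smul ((p * r : ℝ) / m), ?_⟩
  -- A probability measure on unit vectors exists, so the space is not zero-dimensional.
  have hpr : (p * r : ℝ) ≠ 0 := by
    intro h0
    obtain ⟨v, hv⟩ := (ae_norm_eq_one_sphereUniform (p := p) (r := r)).exists
    have hempty : IsEmpty (Fin p × Fin r) := by
      rw [← Fintype.card_eq_zero_iff]
      simpa using h0
    simp [Subsingleton.elim v 0] at hv
  have hm0 : (m : ℝ) ≠ 0 := by positivity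
  have hb := hf.norm_integral_difference_smul_sub_le (ν := sphereUniform p r) hM hS hR hprox hP hl
    hF hx hμ hμR ae_norm_eq_one_sphereUniform
  rw [integral_inner_smul_sphereUniform] at hb
  rw [integral_smul, integral_finsetSum _ fun j _ => hij j]
  simp_rw [hIj]
  rw [Finset.sum_const, Finset.card_univ, Fintype.card_fin, ← Nat.cast_smul_eq_nsmul ℝ, smul_smul,
    div_mul_cancel₀ _ hm0]
  have hfac : (p * r : ℝ) • (∫ q, Z q ∂(sphereUniform p r).prod D) - riemGrad M f x =
      (p * r : ℝ) • ((∫ q, Z q ∂(sphereUniform p r).prod D) - (p * r : ℝ)⁻¹ • riemGrad M f x) := by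
    rw [smul_sub, smul_inv_smul₀ hpr]
  rw [hfac, norm_smul, Real.norm_eq_abs, abs_of_nonneg (by positivity)]
  calc _ ≤ (p * r : ℝ) * ((4 * l + 30 * χ / (2 * γ)) * μ) := by gcongr
    _ = _ := by ring
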